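/- Let $\mathcal G$ be a context-free grammar with finite alphabet, finitely many non-terminals and axiom $S$, in Chomsky normal form: every rule is of the form $N\to AB$ (product), $N\to A$ (an alternative of a union $N\to A\mid B$) or $N\to t$ (terminal), and in addition a rule $S\to\varepsilon$ is allowed if $S$ occurs in no right-hand side. Let $\mathcal G$ be unambiguous: for a given derivation policy (a function pointing at the non-terminal to be rewritten next in every word accessible from $S$ that contains a non-terminal) each word of the language has exactly one derivation from $S$ consistent with the policy. Let $\pi$ assign a real weight to each terminal; the weight of a terminal word is the product of the weights of its letters, and $\pi(L)$ is the sum of the weights of the words of a finite language $L$. For a word $\omega=\omega_1\cdots\omega_k$ of terminals and non-terminals and $\mathbf n\in\mathbb N^k$ let $\mathcal L(\omega,\mathbf n)=\prod_i\mathcal L(\omega_i,n_i)$, where $\mathcal L(x,m)$ is the set of terminal words of length $m$ derivable from the symbol $x$, and let $\pi(\omega,\mathbf n)=\pi(\mathcal L(\omega,\mathbf n))$. Write $N_m$ for a non-terminal $N$ with attached length $m$. An atomic derivation replaces, in a word with attached lengths, one $N_m$ by the right-hand side of a rule $N\to X$ whose symbols carry lengths with sum $m$. A non-terminal is called useful if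 it occurs in a derivation from $S$ of a word of the language. 1. For every useful $N$ the sequence $m\mapsto\pi(N_m)$ satisfies a linear recurrence with polynomial coefficients, not all zero. 2. If $\omega'=\alpha X\beta$ is obtained from $\omega=\alpha N_m\beta$ by an atomic derivation and $\pi(N_m)\neq0$, then $\pi(\omega')=\pi(\omega)\,\pi(X)/\pi(N_m)$. 3. Consider a machine with exact real arithmetic (division by zero undefined), real constants, arrays of reals, natural-number index registers with addition and truncated subtraction, tests $x=0$ for reals and $i\le j$ for indices, and bounded loops. There are a program $P$, a program $Q_r$ for each rule $r$, and a constant $C$, depending only on $\mathcal G$ and $\pi$, such that the following holds. On every input $n$ the program $P$ terminates, and it performs $\Theta(n)$ arithmetic operations (and $\Theta(n)$ elementary steps in all); it stores $\pi(N_j)$ for all useful $N$ and all $j\le n$. Let $(\omega,\mathbf n)$ have total length $\sum_i n_i\le n$, where $\omega$ is accessible from $S$ or contains only useful non-terminals, and let $(\omega',\mathbf n')$ be obtained from it by an atomic derivation applying $r:N\to X$ to some $N_m$, where $\pi\ge0$ or $\pi(N_m)\ne0$. Then $Q_r$, run on the memory left by $P$ with the real input $\pi(\omega,\mathbf n)$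 and the lengths $m$ and those attached to $X$, computes $\pi(\omega',\mathbf n')$ in at most $C$ arithmetic operations (and at most $C$ elementary steps), and leaves the stored arrays unchanged. -/

import Mathlib

open Asymptotics Filter Polynomial

/-! ### Context-free grammars in Chomsky normal form, derivation policies, unambiguity -/

namespace ImmatureWords

variable {T : Type*}

/-- Chomsky normal form with union rules: every rule is a product rule `N → A B`, one of the
alternatives `N → A` of a union rule `N → A | B`, or a terminal rule `N → t`; moreover the axiom
may have the rule `S → ε`, provided `S` appears in no right-hand side. -/
def IsCNF (g : ContextFreeGrammar T) : Prop :=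
  ∀ r ∈ g.rules,
    (∃ A B, r.output = [Symbol.nonterminal A, Symbol.nonterminal B]) ∨
    (∃ A, r.output = [Symbol.nonterminal A]) ∨
    (∃ t, r.output = [Symbol.terminal t]) ∨
    (r.output = [] ∧ r.input = g.initial ∧
      ∀ r' ∈ g.rules, Symbol.nonterminal g.initial ∉ r'.output)

/-- A derivation policy: it points at (the position of) a non-terminal in every word accessible
from the axiom that still contains one, and at nothing in the words of the language. Its values
on words that are not accessible from the axiom are irrelevant. -/
structure DerivationPolicy (g : ContextFreeGrammar T) where
  pos : List (Symbol T g.NT) → Option ℕ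
  pos_mature : ∀ w ∈ g.language, pos (w.map Symbol.terminal) = none
  pos_immature : ∀ ω, g.Derives [Symbol.nonterminal g.initial] ω →
    (∃ N, Symbol.nonterminal N ∈ ω) →
    ∃ i N, pos ω = some i ∧ ω[i]? = some (Symbol.nonterminal N)

/-- The atomic derivation from `ω` to `ω'` that applies the rule `r` at the position to which the
policy points. -/
def PolicyStep {g : ContextFreeGrammar T} (φ : DerivationPolicy g)
    (r : ContextFreeRule T g.NT) (ω ω' : List (Symbol T g.NT)) : Prop :=
  r ∈ g.rules ∧ ∃ α β, ω = α ++ [Symbol.nonterminal r.input] ++ β ∧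
    ω' = α ++ r.output ++ β ∧ φ.pos ω = some α.length

/-- `PolicyDerivation φ ω rs ω'`: applying successively the rules `rs`, each at the position to
which the policy points, leads from `ω` to `ω'`. -/
inductive PolicyDerivation {g : ContextFreeGrammar T} (φ : DerivationPolicy g) :
    List (Symbol T g.NT) → List (ContextFreeRule T g.NT) → List (Symbol T g.NT) → Prop
  | nil (ω : List (Symbol T g.NT)) : PolicyDerivation φ ω [] ω
  | cons {r : ContextFreeRule T g.NT} {rs : List (ContextFreeRule T g.NT)}
      {ω ω' ω'' : List (Symbol T g.NT)} :
      PolicyStep φ r ω ω' → PolicyDerivation φ ω' rs ω'' → PolicyDerivation φ ω (r :: rs) ω''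

/-- Every word of the language is produced from the axiom by exactly one sequence of atomic
derivations that is consistent with the policy. -/
def Unambiguous {g : ContextFreeGrammar T} (φ : DerivationPolicy g) : Prop :=
  ∀ w ∈ g.language, ∃! rs : List (ContextFreeRule T g.NT),
    PolicyDerivation φ [Symbol.nonterminal g.initial] rs (w.map Symbol.terminal)

/-- A non-terminal that takes part in the derivation of at least one word of the language. -/
def Useful (g : ContextFreeGrammar T) (N : g.NT) : Prop :=
  ∃ (α β : List (Symbol T g.NT)) (w : List T),
    g.Derives [Symbol.nonterminal g.initial] (α ++ [Symbol.nonterminal N] ++ β) ∧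
    g.Derives (α ++ [Symbol.nonterminal N] ++ β) (w.map Symbol.terminal)

/-! ### Words with attached lengths, their languages and their weights -/

/-- A word together with a vector of lengths, one for each of its symbols. -/
abbrev SizedWord (g : ContextFreeGrammar T) := List (Symbol T g.NT × ℕ)

/-- The words of length `m` generated from one symbol. -/
def symbolLanguage (g : ContextFreeGrammar T) (x : Symbol T g.NT) (m : ℕ) : Language T :=
  {w : List T | g.Derives [x] (w.map Symbol.terminal) ∧ w.length = m}

/-- The language of a sized word: the concatenation product of the languages of its symbols. -/
def sizedLanguage (g : ContextFreeGrammar T) (ω : SizedWord g) : Language T :=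
  (ω.map fun p => symbolLanguage g p.1 p.2).prod

/-- The total length prescribed by a sized word. -/
def totalLength {g : ContextFreeGrammar T} (ω : SizedWord g) : ℕ := (ω.map Prod.snd).sum

theorem length_of_mem_sizedLanguage (g : ContextFreeGrammar T) (ω : SizedWord g) :
    ∀ w ∈ sizedLanguage g ω, w.length = totalLength ω := by
  induction ω with
  | nil =>
    intro w hw
    have h : w = [] := by simpa [sizedLanguage] using hw
    simp [h, totalLength]
  | cons p ω ih =>
    intro w hw
    have hw' : w ∈ symbolLanguage g p.1 p.2 * sizedLanguage g ω := by
      simpa [sizedLanguage] using hw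
    obtain ⟨a, ha, b, hb, rfl⟩ := Language.mem_mul.1 hw'
    have h1 : a.length = p.2 := ha.2
    have h2 := ih b hb
    simp only [totalLength] at h2
    simp [totalLength, h1, h2]

/-- Over a finite alphabet the language of a sized word is finite, so that the sum that defines
its weight is an honest finite sum. -/
theorem finite_sizedLanguage [Finite T] (g : ContextFreeGrammar T) (ω : SizedWord g) :
    Set.Finite {w : List T | w ∈ sizedLanguage g ω} :=
  (List.finite_length_eq T (totalLength ω)).subset
    fun w hw => length_of_mem_sizedLanguage g ω w hw

/-- The weight of a mature word. -/
def wordWeight (wt : T → ℝ) (w : List T) : ℝ := (w.map wt).prod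

/-- The total weight of the (finite) language of a sized word. -/
noncomputable def weight (wt : T → ℝ) (g : ContextFreeGrammar T) (ω : SizedWord g) : ℝ :=
  ∑ᶠ w ∈ sizedLanguage g ω, wordWeight wt w

/-- The weight of the words of length `m` generated from the non-terminal `N`. -/
noncomputable def ntWeight (wt : T → ℝ) (g : ContextFreeGrammar T) (N : g.NT) (m : ℕ) : ℝ :=
  weight wt g [(Symbol.nonterminal N, m)]

/-- The sequence `a` satisfies a linear recurrence with polynomial coefficients. -/
def IsHolonomic (a : ℕ → ℝ) : Prop :=
  ∃ (d : ℕ) (p : ℕ → ℝ[X]), p d ≠ 0 ∧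
    ∀ m : ℕ, ∑ k ∈ Finset.range (d + 1), (p k).eval (m : ℝ) * a (m + k) = 0

/-! ### A machine with exact real arithmetic and a count of the operations -/

/-- Memory of the machine: index registers holding natural numbers, registers holding real
numbers, and arrays of real numbers (a program names only finitely many of them). -/
structure State where
  idx : ℕ → ℕ
  reg : ℕ → ℝ
  mem : ℕ → ℕ → ℝ

/-- The four arithmetic operations. -/
inductive ArithOp
  | add | sub | mul | div

open Classical in
/-- Value of an arithmetic operation; division by zero is undefined. -/
noncomputable def ArithOp.apply : ArithOp → ℝ → ℝ → Option ℝ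
  | .add, x, y => some (x + y)
  | .sub, x, y => some (x - y)
  | .mul, x, y => some (x * y)
  | .div, x, y => if y = 0 then none else some (x / y)

/-- Programs. -/
inductive Prog
  /-- do nothing -/
  | skip
  /-- sequential composition -/
  | seq (c d : Prog)
  /-- `idx i := k` -/
  | idxConst (i k : ℕ)
  /-- `idx i := idx j + idx k` -/
  | idxAdd (i j k : ℕ)
  /-- `idx i := idx j - idx k` (truncated at zero) -/
  | idxSub (i j k : ℕ)
  /-- `reg i := x` -/
  | const (i : ℕ) (x : ℝ)
  /-- `reg i := reg j op reg k` -/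
  | arith (op : ArithOp) (i j k : ℕ)
  /-- `reg i := mem a (idx j)` -/
  | load (i a j : ℕ)
  /-- `mem a (idx j) := reg i` -/
  | store (a j i : ℕ)
  /-- if `reg i = 0` then `c` else `d` -/
  | ifZero (i : ℕ) (c d : Prog)
  /-- if `idx i ≤ idx j` then `c` else `d` -/
  | ifLe (i j : ℕ) (c d : Prog)
  /-- execute `c` as many times as the value of `idx j` on entry -/
  | loop (j : ℕ) (c : Prog)

/-- Number of operations performed: `arith` counts the arithmetic operations on real numbers,
`steps` counts all executed instructions, tests and loop iterations, arithmetic or not. -/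
structure Cost where
  arith : ℕ
  steps : ℕ

/-- Execute `f` in sequence `k` times, adding up the costs, with one more step per iteration. -/
def iter (f : State → Option (State × Cost)) : ℕ → State → Option (State × Cost)
  | 0, s => some (s, ⟨0, 0⟩)
  | k + 1, s =>
    (f s).bind fun p => (iter f k p.1).bind fun q =>
      some (q.1, ⟨p.2.arith + q.2.arith, p.2.steps + q.2.steps + 1⟩)

open Classical in
/-- Execution of a program: the final memory and the cost, or `none` after a division by zero. -/
noncomputable def run : Prog → State → Option (State × Cost)
  | .skip, s => some (s, ⟨0, 0⟩)
  | .seq c d, s =>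
    (run c s).bind fun p => (run d p.1).bind fun q =>
      some (q.1, ⟨p.2.arith + q.2.arith, p.2.steps + q.2.steps⟩)
  | .idxConst i k, s => some ({ s with idx := Function.update s.idx i k }, ⟨0, 1⟩)
  | .idxAdd i j k, s =>
    some ({ s with idx := Function.update s.idx i (s.idx j + s.idx k) }, ⟨0, 1⟩)
  | .idxSub i j k, s =>
    some ({ s with idx := Function.update s.idx i (s.idx j - s.idx k) }, ⟨0, 1⟩)
  | .const i x, s => some ({ s with reg := Function.update s.reg i x }, ⟨0, 1⟩)
  | .arith op i j k, s =>
    (op.apply (s.reg j) (s.reg k)).bind fun x =>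
      some ({ s with reg := Function.update s.reg i x }, ⟨1, 1⟩)
  | .load i a j, s =>
    some ({ s with reg := Function.update s.reg i (s.mem a (s.idx j)) }, ⟨0, 1⟩)
  | .store a j i, s =>
    some (⟨s.idx, s.reg,
      Function.update s.mem a (Function.update (s.mem a) (s.idx j) (s.reg i))⟩, ⟨0, 1⟩)
  | .ifZero i c d, s =>
    (if s.reg i = 0 then run c s else run d s).bind fun p =>
      some (p.1, ⟨p.2.arith, p.2.steps + 1⟩)
  | .ifLe i j c d, s =>
    (if s.idx i ≤ s.idx j then run c s else run d s).bind fun p =>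
      some (p.1, ⟨p.2.arith, p.2.steps + 1⟩)
  | .loop j c, s =>
    (iter (run c) (s.idx j) s).bind fun p => some (p.1, ⟨p.2.arith, p.2.steps + 1⟩)

/-- The initial memory on input `n`: `idx 0` holds `n` and everything else is zero. -/
def initState (n : ℕ) : State where
  idx := Function.update (fun _ => 0) 0 n
  reg := fun _ => 0
  mem := fun _ _ => 0

end ImmatureWords

/-!
A leftmost derivation, read as a list of rules, is the preorder code of a parse forest (`Parse`);
such codes are prefix-free. Two parses over an accessible form can be rescheduled to derivations
that follow the policy without becoming equal (`exists_policyDerivation_pair`), so unambiguity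
for one policy means that every word has at most one parse from the axiom, hence also from each
useful non-terminal (`Unambiguous.uniqueParse`). Consequently the generating functions of the
weights multiply along right-hand sides and add up over the rules of a useful non-terminal
(`formSeries_append`, `formSeries_nonterminal`), and no useful non-terminal derives itself by rules
`N → A`, because such a cycle could be inserted into a parse.

The generating functions therefore solve a polynomial system over `ℝ[X]`. At `X = 0` the matrix of
its linearisation is `1 - M`, where `M` is supported on the acyclic relation given by the rules
`N → A`; so the Jacobian is invertible. The Kähler differentials of the solution are killed by this
matrix, hence the field that the solution generates over `ℝ(X)` has no differentials, is formally
unramified, and thus of finite degree (`finiteDimensional_adjoin_of_det_ne_zero`). This field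
contains the images of the solution under all powers of the Euler derivation `X · d/dX`; a linear
dependence among these is, coefficient by coefficient, the recurrence
(`isHolonomic_of_polynomial_system`).

The update formula needs no unambiguity: the attached lengths alone make concatenation products
unambiguous (`weight_append`).

The precomputation unrolls one recurrence for each useful non-terminal from beyond the zeros of its
leading coefficient, the values before being constants of the program. The arrays of the useless
non-terminals stay zero. The update divides by the stored weight of the rewritten non-terminal and
returns zero if that is zero. This is correct for useless symbols as well: a right-hand side of a
useful non-terminal with a useless symbol generates nothing, and neither does an accessible form
with a useless non-terminal (`weight_update_stored`).
-/

namespace ImmatureWords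

variable {T : Type*} {wt : T → ℝ} {g : ContextFreeGrammar T}

/-! ### Leftmost derivations as codes of parse forests -/

/-- `Parse g ω rs w`: the leftmost derivation of the terminal word `w` from `ω` applies the rules
`rs`, in this order. The list `rs` is the preorder reading of the parse forest of `w` over `ω`, so
that `Parse` records parse trees without a data type of trees. -/
inductive Parse (g : ContextFreeGrammar T) :
    List (Symbol T g.NT) → List (ContextFreeRule T g.NT) → List T → Prop
  | nil : Parse g [] [] []
  | terminal (t : T) {ω rs w} : Parse g ω rs w → Parse g (Symbol.terminal t :: ω) rs (t :: w)
  | rule {r : ContextFreeRule T g.NT} {ω rs w} : r ∈ g.rules → Parse g (r.output ++ ω) rs w →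
      Parse g (Symbol.nonterminal r.input :: ω) (r :: rs) w

/-- Every terminal word has at most one parse over `ω`. -/
def UniqueParse (g : ContextFreeGrammar T) (ω : List (Symbol T g.NT)) : Prop :=
  ∀ w rs rs', Parse g ω rs w → Parse g ω rs' w → rs = rs'

/-- Some terminal word can be derived from `ω`. -/
def Productive (g : ContextFreeGrammar T) (ω : List (Symbol T g.NT)) : Prop :=
  ∃ w : List T, g.Derives ω (w.map Symbol.terminal)

theorem Parse.append {ω₁ ω₂ : List (Symbol T g.NT)} {rs₁ rs₂ : List (ContextFreeRule T g.NT)}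
    {w₁ w₂ : List T} (h₁ : Parse g ω₁ rs₁ w₁) (h₂ : Parse g ω₂ rs₂ w₂) :
    Parse g (ω₁ ++ ω₂) (rs₁ ++ rs₂) (w₁ ++ w₂) := by
  induction h₁ with
  | nil => simpa using h₂
  | terminal t _ ih => exact .terminal t ih
  | rule hr _ ih => exact .rule hr (by simpa using ih)

theorem Parse.exists_of_append {ω₁ ω₂ : List (Symbol T g.NT)}
    {rs : List (ContextFreeRule T g.NT)} {w : List T} (h : Parse g (ω₁ ++ ω₂) rs w) :
    ∃ rs₁ rs₂ w₁ w₂, rs = rs₁ ++ rs₂ ∧ w = w₁ ++ w₂ ∧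
      Parse g ω₁ rs₁ w₁ ∧ Parse g ω₂ rs₂ w₂ := by
  generalize hω : ω₁ ++ ω₂ = ω at h
  induction h generalizing ω₁ with
  | nil =>
    obtain ⟨rfl, rfl⟩ := List.append_eq_nil_iff.1 hω
    exact ⟨[], [], [], [], rfl, rfl, .nil, .nil⟩
  | @terminal t ω rs w h ih =>
    rcases List.append_eq_cons_iff.1 hω with ⟨rfl, rfl⟩ | ⟨ω₁', rfl, rfl⟩
    · exact ⟨[], rs, [], t :: w, rfl, rfl, .nil, .terminal t h⟩
    · obtain ⟨a, b, u, v, rfl, rfl, h₁, h₂⟩ := ih rfl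
      exact ⟨a, b, t :: u, v, rfl, rfl, .terminal t h₁, h₂⟩
  | @rule r ω rs w hr h ih =>
    rcases List.append_eq_cons_iff.1 hω with ⟨rfl, rfl⟩ | ⟨ω₁', rfl, rfl⟩
    · exact ⟨[], r :: rs, [], w, rfl, rfl, .nil, .rule hr h⟩
    · obtain ⟨a, b, u, v, rfl, rfl, h₁, h₂⟩ := ih (ω₁ := r.output ++ ω₁') (by simp)
      exact ⟨r :: a, b, u, v, rfl, rfl, .rule hr h₁, h₂⟩

/-- Codes of parses over `ω` are prefix-free, and a code determines the word. -/
theorem Parse.prefix_free {ω : List (Symbol T g.NT)} {a b a' b' : List (ContextFreeRule T g.NT)}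
    {w w' : List T} (h : Parse g ω a w) (h' : Parse g ω a' w') (hab : a ++ b = a' ++ b') :
    a = a' ∧ b = b' ∧ w = w' := by
  induction h generalizing a' w' with
  | nil => cases h'; exact ⟨rfl, hab, rfl⟩
  | terminal t _ ih =>
    cases h' with
    | terminal _ h' =>
      obtain ⟨rfl, rfl, rfl⟩ := ih h' hab
      exact ⟨rfl, rfl, rfl⟩
  | @rule r ω rs w hr h ih =>
    generalize hx : Symbol.nonterminal r.input :: ω = ω₀ at h'
    cases h' with
    | nil => cases hx
    | terminal _ _ => cases hx
    | @rule r' ω' rs' w' hr' h' =>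
      rw [List.cons_append, List.cons_append, List.cons.injEq] at hab
      obtain ⟨rfl, hab⟩ := hab
      cases hx
      obtain ⟨rfl, rfl, rfl⟩ := ih h' hab
      exact ⟨rfl, rfl, rfl⟩

theorem Parse.singleton_nonterminal_iff {N : g.NT}
    {rs : List (ContextFreeRule T g.NT)} {w : List T} :
    Parse g [Symbol.nonterminal N] rs w ↔
      ∃ r ∈ g.rules, ∃ rs', r.input = N ∧ rs = r :: rs' ∧ Parse g r.output rs' w := by
  constructor
  · intro h
    generalize hω : [Symbol.nonterminal N] = ω at h
    cases h with
    | nil => cases hω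
    | terminal => cases hω
    | @rule r ω rs w hr h =>
      cases hω
      exact ⟨r, hr, rs, rfl, rfl, by simpa using h⟩
  · rintro ⟨r, hr, rs', rfl, rfl, h⟩
    exact .rule hr (by simpa using h)

theorem Parse.singleton_terminal_iff {t : T} {rs : List (ContextFreeRule T g.NT)} {w : List T} :
    Parse g [Symbol.terminal t] rs w ↔ rs = [] ∧ w = [t] := by
  constructor
  · intro h
    cases h with
    | terminal _ h => cases h; exact ⟨rfl, rfl⟩
  · rintro ⟨rfl, rfl⟩
    exact .terminal t .nil

theorem Parse.split_at {α β : List (Symbol T g.NT)} {x : Symbol T g.NT}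
    {rs : List (ContextFreeRule T g.NT)} {w : List T} (h : Parse g (α ++ [x] ++ β) rs w) :
    ∃ a c b u v z, rs = a ++ c ++ b ∧ w = u ++ v ++ z ∧
      Parse g α a u ∧ Parse g [x] c v ∧ Parse g β b z := by
  obtain ⟨ac, b, uv, z, rfl, rfl, h, hb⟩ := h.exists_of_append
  obtain ⟨a, c, u, v, rfl, rfl, ha, hc⟩ := h.exists_of_append
  exact ⟨a, c, b, u, v, z, rfl, rfl, ha, hc, hb⟩

theorem parse_map_terminal (w : List T) : Parse g (w.map Symbol.terminal) [] w := by
  induction w with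
  | nil => exact .nil
  | cons t w ih => exact .terminal t ih

theorem Parse.eq_of_map_terminal {w w' : List T} {rs : List (ContextFreeRule T g.NT)}
    (h : Parse g (w.map Symbol.terminal) rs w') : rs = [] ∧ w' = w := by
  induction w generalizing w' with
  | nil => cases h; exact ⟨rfl, rfl⟩
  | cons t w ih =>
    cases h with
    | terminal _ h => obtain ⟨rfl, rfl⟩ := ih h; exact ⟨rfl, rfl⟩

theorem Parse.derives {ω : List (Symbol T g.NT)} {rs : List (ContextFreeRule T g.NT)}
    {w : List T} (h : Parse g ω rs w) : g.Derives ω (w.map Symbol.terminal) := by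
  induction h with
  | nil => exact .refl _
  | terminal t _ ih => exact ih.append_left [Symbol.terminal t]
  | @rule r ω rs w hr _ ih =>
    exact ContextFreeGrammar.Produces.trans_derives ⟨r, hr, .head ω⟩ ih

/-- A rule applied anywhere in a sentential form extends a parse by one rule. -/
theorem Parse.exists_of_produces {ω ω' : List (Symbol T g.NT)}
    {rs : List (ContextFreeRule T g.NT)} {w : List T} (h : g.Produces ω ω')
    (hp : Parse g ω' rs w) : ∃ rs', Parse g ω rs' w := by
  obtain ⟨r, hr, hrw⟩ := h
  obtain ⟨α, β, rfl, rfl⟩ := hrw.exists_parts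
  obtain ⟨ax, b, ux, z, rfl, rfl, hp, hb⟩ := hp.exists_of_append
  obtain ⟨a, x, u, v, rfl, rfl, ha, hx⟩ := hp.exists_of_append
  exact ⟨_, (ha.append (Parse.singleton_nonterminal_iff.2 ⟨r, hr, x, rfl, rfl, hx⟩)).append hb⟩

theorem exists_parse_iff {ω : List (Symbol T g.NT)} {w : List T} :
    (∃ rs, Parse g ω rs w) ↔ g.Derives ω (w.map Symbol.terminal) := by
  refine ⟨fun ⟨rs, h⟩ => h.derives, fun h => ?_⟩
  induction h using Relation.ReflTransGen.head_induction_on with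
  | refl => exact ⟨[], parse_map_terminal w⟩
  | head h _ ih =>
    obtain ⟨rs, hrs⟩ := ih
    exact hrs.exists_of_produces h

/-! ### From policy derivations to unique parses -/

/-- Two parses of words over an accessible form can be rescheduled according to the policy in
such a way that the rescheduled derivations agree only if the parses do. -/
theorem exists_policyDerivation_pair (φ : DerivationPolicy g) {ω : List (Symbol T g.NT)}
    {rs rs' : List (ContextFreeRule T g.NT)} {w w' : List T}
    (hω : g.Derives [Symbol.nonterminal g.initial] ω)
    (h : Parse g ω rs w) (h' : Parse g ω rs' w') :
    ∃ ps ps', PolicyDerivation φ ω ps (w.map Symbol.terminal) ∧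
      PolicyDerivation φ ω ps' (w'.map Symbol.terminal) ∧ (ps = ps' → rs = rs') := by
  -- the maximum, because below different rules each parse is rescheduled alone
  induction hn : max rs.length rs'.length using Nat.strong_induction_on
    generalizing ω rs rs' w w' with
  | _ n ih =>
  by_cases hN : ∃ N, Symbol.nonterminal N ∈ ω
  · obtain ⟨i, N, hi, hiN⟩ := φ.pos_immature ω hω hN
    obtain ⟨hlt, hget⟩ := List.getElem?_eq_some_iff.1 hiN
    have hsplit : ω = ω.take i ++ [Symbol.nonterminal N] ++ ω.drop (i + 1) := by
      rw [← hget]; simp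
    have hlen : (ω.take i).length = i := by simp [hlt.le]
    generalize hα : ω.take i = α at *
    generalize ω.drop (i + 1) = β at *
    subst hsplit
    obtain ⟨a, c, b, u, v, z, rfl, rfl, ha, hc, hb⟩ := h.split_at
    obtain ⟨a', c', b', u', v', z', rfl, rfl, ha', hc', hb'⟩ := h'.split_at
    obtain ⟨r, hr, x, hrN, rfl, hx⟩ := Parse.singleton_nonterminal_iff.1 hc
    obtain ⟨r', hr', x', hrN', rfl, hx'⟩ := Parse.singleton_nonterminal_iff.1 hc'
    have step : ∀ q ∈ g.rules, q.input = N →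
        PolicyStep φ q (α ++ [Symbol.nonterminal N] ++ β) (α ++ q.output ++ β) := by
      rintro q hq rfl
      exact ⟨hq, α, β, rfl, rfl, by rw [hi, hlen]⟩
    have acc : ∀ q ∈ g.rules, q.input = N →
        g.Derives [Symbol.nonterminal g.initial] (α ++ q.output ++ β) := by
      rintro q hq rfl
      exact hω.trans_produces ⟨q, hq, q.rewrites_of_exists_parts α β⟩
    have hp := (ha.append hx).append hb
    have hp' := (ha'.append hx').append hb'
    by_cases hrr : r = r'
    · subst hrr
      obtain ⟨ps, ps', h1, h2, h3⟩ := ih _ (by simp at hn ⊢; omega) (acc r hr hrN) hp hp' rfl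
      refine ⟨r :: ps, r :: ps', .cons (step r hr hrN) h1, .cons (step r hr hrN) h2, ?_⟩
      intro he
      have he := h3 (List.cons.inj he).2
      rw [List.append_assoc, List.append_assoc] at he
      obtain ⟨rfl, he, -⟩ := ha.prefix_free ha' he
      obtain ⟨rfl, rfl, -⟩ := hx.prefix_free hx' he
      rfl
    · obtain ⟨ps, -, h1, -⟩ := ih _ (by simp at hn ⊢; omega) (acc r hr hrN) hp hp rfl
      obtain ⟨ps', -, h2, -⟩ := ih _ (by simp at hn ⊢; omega) (acc r' hr' hrN') hp' hp' rfl
      exact ⟨r :: ps, r' :: ps', .cons (step r hr hrN) h1, .cons (step r' hr' hrN') h2,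
        fun he => (hrr (List.cons.inj he).1).elim⟩
  · have : ∃ w₀ : List T, ω = w₀.map Symbol.terminal := by
      clear h h' hω hn ih
      induction ω with
      | nil => exact ⟨[], rfl⟩
      | cons x ω ihω =>
        obtain ⟨w₀, rfl⟩ := ihω fun ⟨N, hN'⟩ => hN ⟨N, List.mem_cons_of_mem _ hN'⟩
        cases x with
        | terminal t => exact ⟨t :: w₀, rfl⟩
        | nonterminal N => exact (hN ⟨N, List.mem_cons_self⟩).elim
    obtain ⟨w₀, rfl⟩ := this
    obtain ⟨rfl, rfl⟩ := h.eq_of_map_terminal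
    obtain ⟨rfl, rfl⟩ := h'.eq_of_map_terminal
    exact ⟨[], [], .nil _, .nil _, fun _ => rfl⟩

theorem Unambiguous.uniqueParse_initial {φ : DerivationPolicy g} (h : Unambiguous φ) :
    UniqueParse g [Symbol.nonterminal g.initial] := by
  intro w rs rs' hrs hrs'
  obtain ⟨ps, ps', h1, h2, h3⟩ := exists_policyDerivation_pair φ (.refl _) hrs hrs'
  exact h3 ((h w hrs.derives).unique h1 h2)

theorem UniqueParse.of_produces {ω ω' : List (Symbol T g.NT)} (h : UniqueParse g ω)
    (hp : g.Produces ω ω') : UniqueParse g ω' := by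
  obtain ⟨r, hr, hrw⟩ := hp
  obtain ⟨α, β, rfl, rfl⟩ := hrw.exists_parts
  intro w rs rs' hrs hrs'
  obtain ⟨ax, b, ux, z, rfl, rfl, hp, hb⟩ := hrs.exists_of_append
  obtain ⟨a, x, u, v, rfl, rfl, ha, hx⟩ := hp.exists_of_append
  obtain ⟨ax', b', ux', z', rfl, hw, hp', hb'⟩ := hrs'.exists_of_append
  obtain ⟨a', x', u', v', rfl, rfl, ha', hx'⟩ := hp'.exists_of_append
  have key := h _ _ _
    ((ha.append (Parse.singleton_nonterminal_iff.2 ⟨r, hr, x, rfl, rfl, hx⟩)).append hb)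
    (hw ▸ (ha'.append (Parse.singleton_nonterminal_iff.2 ⟨r, hr, x', rfl, rfl, hx'⟩)).append hb')
  simp only [List.append_assoc] at key ⊢
  obtain ⟨rfl, key, -⟩ := ha.prefix_free ha' key
  obtain ⟨rfl, rfl, -⟩ := hx.prefix_free hx' (List.cons.inj key).2
  rfl

theorem UniqueParse.of_derives {ω ω' : List (Symbol T g.NT)} (h : UniqueParse g ω)
    (hp : g.Derives ω ω') : UniqueParse g ω' := by
  induction hp with
  | refl => exact h
  | tail _ h' ih => exact ih.of_produces h'

/-- Parses over a factor extend to parses over the whole form, once the rest is productive. -/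
theorem UniqueParse.of_append {α ω β : List (Symbol T g.NT)} (h : UniqueParse g (α ++ ω ++ β))
    (hα : Productive g α) (hβ : Productive g β) : UniqueParse g ω := by
  obtain ⟨u, hu⟩ := hα
  obtain ⟨z, hz⟩ := hβ
  obtain ⟨a, ha⟩ := exists_parse_iff.2 hu
  obtain ⟨b, hb⟩ := exists_parse_iff.2 hz
  intro w rs rs' hrs hrs'
  have key := h _ _ _ ((ha.append hrs).append hb) ((ha.append hrs').append hb)
  simpa using key

theorem productive_append {ω₁ ω₂ : List (Symbol T g.NT)} :
    Productive g (ω₁ ++ ω₂) ↔ Productive g ω₁ ∧ Productive g ω₂ := by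
  constructor
  · rintro ⟨w, hw⟩
    obtain ⟨rs, hrs⟩ := exists_parse_iff.2 hw
    obtain ⟨a, b, u, v, -, -, h1, h2⟩ := hrs.exists_of_append
    exact ⟨⟨u, h1.derives⟩, ⟨v, h2.derives⟩⟩
  · rintro ⟨⟨u, hu⟩, ⟨v, hv⟩⟩
    obtain ⟨a, ha⟩ := exists_parse_iff.2 hu
    obtain ⟨b, hb⟩ := exists_parse_iff.2 hv
    exact ⟨_, (ha.append hb).derives⟩

theorem Productive.of_mem {ω : List (Symbol T g.NT)} {x : Symbol T g.NT} (h : Productive g ω)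
    (hx : x ∈ ω) : Productive g [x] := by
  obtain ⟨α, β, rfl⟩ := List.append_of_mem hx
  rw [List.append_cons] at h
  exact (productive_append.1 (productive_append.1 h).1).2

theorem productive_of_rule {r : ContextFreeRule T g.NT} (hr : r ∈ g.rules)
    (h : Productive g r.output) : Productive g [Symbol.nonterminal r.input] := by
  obtain ⟨w, hw⟩ := h
  exact ⟨w, ContextFreeGrammar.Produces.trans_derives ⟨r, hr, r.rewrites_of_exists_parts [] []⟩
    (by simpa using hw)⟩

theorem useful_iff {N : g.NT} : Useful g N ↔ ∃ α β : List (Symbol T g.NT),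
    g.Derives [Symbol.nonterminal g.initial] (α ++ [Symbol.nonterminal N] ++ β) ∧
      Productive g (α ++ [Symbol.nonterminal N] ++ β) := by
  simp only [Useful, Productive, exists_and_left]

theorem Useful.productive {N : g.NT} (h : Useful g N) :
    Productive g [Symbol.nonterminal N] := by
  obtain ⟨α, β, -, h⟩ := useful_iff.1 h
  exact h.of_mem (by simp)

/-- Non-terminals of an accessible productive form are useful. -/
theorem useful_of_mem {ω : List (Symbol T g.NT)} {N : g.NT}
    (hω : g.Derives [Symbol.nonterminal g.initial] ω) (h : Productive g ω)
    (hN : Symbol.nonterminal N ∈ ω) : Useful g N := by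
  obtain ⟨α, β, rfl⟩ := List.append_of_mem hN
  rw [List.append_cons] at h hω
  exact useful_iff.2 ⟨α, β, hω, h⟩

theorem Useful.of_rule {r : ContextFreeRule T g.NT} {N : g.NT} (h : Useful g r.input)
    (hr : r ∈ g.rules) (hp : Productive g r.output) (hN : Symbol.nonterminal N ∈ r.output) :
    Useful g N := by
  obtain ⟨α, β, hd, hpr⟩ := useful_iff.1 h
  rw [productive_append, productive_append] at hpr
  refine useful_of_mem (hd.trans_produces ⟨r, hr, r.rewrites_of_exists_parts α β⟩) ?_
    (List.mem_append_left _ (List.mem_append_right _ hN))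
  rw [productive_append, productive_append]
  exact ⟨⟨hpr.1.1, hp⟩, hpr.2⟩

theorem Unambiguous.uniqueParse {φ : DerivationPolicy g} (h : Unambiguous φ) {N : g.NT}
    (hN : Useful g N) : UniqueParse g [Symbol.nonterminal N] := by
  obtain ⟨α, β, hd, hpr⟩ := useful_iff.1 hN
  rw [productive_append, productive_append] at hpr
  exact (h.uniqueParse_initial.of_derives hd).of_append hpr.1.1 hpr.2

theorem UniqueParse.output {r : ContextFreeRule T g.NT}
    (h : UniqueParse g [Symbol.nonterminal r.input]) (hr : r ∈ g.rules) :
    UniqueParse g r.output :=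
  h.of_produces ⟨r, hr, .input_output⟩

/-- A derivation cycle at a productive non-terminal could be inserted into a parse. -/
theorem UniqueParse.not_transGen_self {N : g.NT} (h : UniqueParse g [Symbol.nonterminal N])
    (hp : Productive g [Symbol.nonterminal N]) :
    ¬ Relation.TransGen (fun A B : g.NT => ∃ r ∈ g.rules, r.input = A ∧
      r.output = [Symbol.nonterminal B]) N N := by
  intro hc
  have lift : ∀ {A B : g.NT}, Relation.TransGen (fun A B : g.NT => ∃ r ∈ g.rules, r.input = A ∧
      r.output = [Symbol.nonterminal B]) A B → ∀ rs w, Parse g [Symbol.nonterminal B] rs w →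
      ∃ c, c ≠ [] ∧ Parse g [Symbol.nonterminal A] (c ++ rs) w := by
    intro A B hAB
    induction hAB using Relation.TransGen.head_induction_on with
    | single h1 =>
      obtain ⟨r, hr, hA, ho⟩ := h1
      exact fun rs w hB => ⟨[r], by simp,
        Parse.singleton_nonterminal_iff.2 ⟨r, hr, rs, hA, rfl, ho ▸ hB⟩⟩
    | head h1 _ ih =>
      obtain ⟨r, hr, hA, ho⟩ := h1
      intro rs w hB
      obtain ⟨c, -, hcp⟩ := ih rs w hB
      exact ⟨r :: c, by simp, Parse.singleton_nonterminal_iff.2 ⟨r, hr, _, hA, rfl, ho ▸ hcp⟩⟩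
  obtain ⟨w, hw⟩ := hp
  obtain ⟨rs, hrs⟩ := exists_parse_iff.2 hw
  obtain ⟨c, hcne, hcp⟩ := lift hc rs w hrs
  exact hcne (by simpa using (h _ _ _ hcp hrs))

/-- In Chomsky normal form only words that contain the axiom can vanish. -/
theorem IsCNF.initial_mem_of_parse_nil (hcnf : IsCNF g) {ω : List (Symbol T g.NT)}
    {rs : List (ContextFreeRule T g.NT)} {w : List T} (h : Parse g ω rs w) (hw : w = [])
    (hω : ω ≠ []) : Symbol.nonterminal g.initial ∈ ω ∧
      ∀ r' ∈ g.rules, Symbol.nonterminal g.initial ∉ r'.output := by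
  induction h with
  | nil => exact (hω rfl).elim
  | terminal => cases hw
  | @rule r ω rs w hr h ih =>
    rcases hcnf r hr with ⟨A, B, ho⟩ | ⟨A, ho⟩ | ⟨t, ho⟩ | ⟨ho, hi, hno⟩
    pick_goal 4
    · exact ⟨by simp [hi], hno⟩
    all_goals
      obtain ⟨hm, hno⟩ := ih hw (by simp [ho])
      have := hno r hr
      exact ⟨List.mem_cons_of_mem _ ((List.mem_append.1 hm).resolve_left this), hno⟩

theorem IsCNF.not_derives_nil (hcnf : IsCNF g) {r : ContextFreeRule T g.NT} {x : Symbol T g.NT}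
    (hr : r ∈ g.rules) (hx : x ∈ r.output) :
    ¬ g.Derives [x] (([] : List T).map Symbol.terminal) := by
  intro h
  obtain ⟨rs, hrs⟩ := exists_parse_iff.2 h
  obtain ⟨hm, hno⟩ := hcnf.initial_mem_of_parse_nil hrs rfl (by simp)
  rw [List.mem_singleton] at hm
  exact hno r hr (hm ▸ hx)

/-! ### Weights of finite languages -/

/-- The sum of the weights of the words of a language (junk value `0` for languages in which
infinitely many words have a non-zero weight). -/
noncomputable def languageWeight (wt : T → ℝ) (L : Language T) : ℝ := ∑ᶠ w ∈ L, wordWeight wt w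

/-- The words of length `m` derived from `ω`. -/
def formLanguage (g : ContextFreeGrammar T) (ω : List (Symbol T g.NT)) (m : ℕ) : Language T :=
  {w : List T | g.Derives ω (w.map Symbol.terminal) ∧ w.length = m}

/-- The generating function of the weights of the words derived from `ω`, graded by length. -/
noncomputable def formSeries (wt : T → ℝ) (g : ContextFreeGrammar T)
    (ω : List (Symbol T g.NT)) : PowerSeries ℝ :=
  .mk fun m => languageWeight wt (formLanguage g ω m)

theorem wordWeight_append (u v : List T) :
    wordWeight wt (u ++ v) = wordWeight wt u * wordWeight wt v := by
  simp [wordWeight]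

theorem finite_formLanguage [Finite T] (ω : List (Symbol T g.NT)) (m : ℕ) :
    Set.Finite (formLanguage g ω m : Set (List T)) :=
  (List.finite_length_eq T m).subset fun _ h => h.2

theorem languageWeight_singleton (w : List T) :
    languageWeight wt ({w} : Set (List T)) = wordWeight wt w :=
  finsum_mem_singleton

/-- The weight of an unambiguous concatenation is the product of the weights. -/
theorem languageWeight_mul {L₁ L₂ : Language T} (h₁ : Set.Finite (L₁ : Set (List T)))
    (h₂ : Set.Finite (L₂ : Set (List T)))
    (hinj : ∀ u ∈ L₁, ∀ u' ∈ L₁, ∀ v ∈ L₂, ∀ v' ∈ L₂, u ++ v = u' ++ v' → u = u' ∧ v = v') :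
    languageWeight wt (L₁ * L₂) = languageWeight wt L₁ * languageWeight wt L₂ := by
  obtain ⟨F₁, rfl⟩ : ∃ F : Finset (List T), L₁ = (↑F : Set (List T)) :=
    ⟨h₁.toFinset, h₁.coe_toFinset.symm⟩
  obtain ⟨F₂, rfl⟩ : ∃ F : Finset (List T), L₂ = (↑F : Set (List T)) :=
    ⟨h₂.toFinset, h₂.coe_toFinset.symm⟩
  have himg : @HMul.hMul (Language T) (Language T) (Language T) _
      (↑F₁ : Set (List T)) (↑F₂ : Set (List T)) =
      ((fun p : List T × List T => p.1 ++ p.2) '' (↑(F₁ ×ˢ F₂) : Set (List T × List T))) := by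
    rw [Finset.coe_product, Set.image_prod]
    rfl
  have hio : Set.InjOn (fun p : List T × List T => p.1 ++ p.2)
      (↑(F₁ ×ˢ F₂) : Set (List T × List T)) := by
    rintro ⟨u, v⟩ h₀ ⟨u', v'⟩ h₀' h
    rw [Finset.coe_product] at h₀ h₀'
    exact Prod.ext_iff.2 (hinj u h₀.1 u' h₀'.1 v h₀.2 v' h₀'.2 h)
  refine (congrArg (languageWeight wt) himg).trans ((finsum_mem_image hio).trans ?_)
  have s₁ : languageWeight wt (↑F₁ : Set (List T)) = ∑ w ∈ F₁, wordWeight wt w :=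
    finsum_mem_coe_finset _ _
  have s₂ : languageWeight wt (↑F₂ : Set (List T)) = ∑ w ∈ F₂, wordWeight wt w :=
    finsum_mem_coe_finset _ _
  rw [s₁, s₂, finsum_mem_coe_finset, Finset.sum_product, Finset.sum_mul_sum]
  simp only [wordWeight_append]

/-- A language whose words have non-negative weights with sum zero has only words of weight
zero, and so has every part of it. -/
theorem languageWeight_eq_zero_of_subset (hwt : ∀ t, 0 ≤ wt t) {L L' : Language T}
    (hL : Set.Finite (L : Set (List T))) (h : languageWeight wt L = 0)
    (hsub : ∀ w ∈ L', w ∈ L) : languageWeight wt L' = 0 := by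
  have s : languageWeight wt L = ∑ w ∈ hL.toFinset, wordWeight wt w :=
    finsum_mem_eq_finite_toFinset_sum _ hL
  have hnn : ∀ w : List T, 0 ≤ wordWeight wt w := fun w =>
    List.prod_nonneg (by simpa using fun t _ => hwt t)
  rw [s, Finset.sum_eq_zero_iff_of_nonneg fun w _ => hnn w] at h
  exact finsum_mem_eq_zero_of_forall_eq_zero fun w hw => h w (hL.mem_toFinset.2 (hsub w hw))

/-! ### Weights of sized words -/

theorem sizedLanguage_append (α β : SizedWord g) :
    sizedLanguage g (α ++ β) = sizedLanguage g α * sizedLanguage g β := by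
  simp [sizedLanguage]

/-- The prescribed lengths make every concatenation of sized languages unambiguous. -/
theorem weight_append [Finite T] (α β : SizedWord g) :
    weight wt g (α ++ β) = weight wt g α * weight wt g β := by
  refine Eq.trans (congrArg (languageWeight wt) (sizedLanguage_append α β)) ?_
  refine languageWeight_mul (finite_sizedLanguage g α) (finite_sizedLanguage g β) ?_
  intro u hu u' hu' v hv v' hv' h
  refine List.append_inj h ?_
  rw [length_of_mem_sizedLanguage g α u hu, length_of_mem_sizedLanguage g α u' hu']

theorem weight_nil : weight wt g [] = 1 := by
  have : sizedLanguage g [] = ({[]} : Set (List T)) := by simp [sizedLanguage]; rfl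
  rw [weight, this]
  exact (languageWeight_singleton []).trans (by simp [wordWeight])

theorem weight_cons [Finite T] (p : Symbol T g.NT × ℕ) (ω : SizedWord g) :
    weight wt g (p :: ω) = weight wt g [p] * weight wt g ω :=
  weight_append [p] ω

theorem sizedLanguage_singleton (x : Symbol T g.NT) (m : ℕ) :
    sizedLanguage g [(x, m)] = formLanguage g [x] m := by
  simp [sizedLanguage]; rfl

theorem weight_singleton (x : Symbol T g.NT) (m : ℕ) :
    weight wt g [(x, m)] = languageWeight wt (formLanguage g [x] m) := by
  rw [weight, sizedLanguage_singleton]; rfl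

theorem languageWeight_formLanguage_terminal (t : T) (m : ℕ) :
    languageWeight wt (formLanguage g [Symbol.terminal t] m) = if m = 1 then wt t else 0 := by
  have h : ∀ w : List T, w ∈ formLanguage g [Symbol.terminal t] m ↔ w = [t] ∧ w.length = m := by
    intro w
    refine and_congr_left fun _ => ?_
    rw [← exists_parse_iff]
    simp [Parse.singleton_terminal_iff]
  split_ifs with hm
  · have e : formLanguage g [Symbol.terminal t] m = ({[t]} : Set (List T)) := by
      ext w
      rw [h, hm]
      exact ⟨fun h => h.1, fun h => ⟨h, by rw [show w = [t] from h]; rfl⟩⟩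
    rw [e]
    exact (languageWeight_singleton _).trans (by simp [wordWeight])
  · refine finsum_mem_eq_zero_of_forall_eq_zero fun w hw => ?_
    obtain ⟨rfl, h1⟩ := (h w).1 hw
    exact (hm h1.symm).elim

theorem derives_of_mem_sizedLanguage {ω : SizedWord g} {w : List T}
    (hw : w ∈ sizedLanguage g ω) : g.Derives (ω.map Prod.fst) (w.map Symbol.terminal) := by
  induction ω generalizing w with
  | nil =>
    have h : w = [] := by simpa [sizedLanguage] using hw
    subst h
    exact .refl _
  | cons p ω ih =>
    rw [← List.singleton_append, sizedLanguage_append, sizedLanguage_singleton] at hw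
    obtain ⟨u, hu, v, hv, rfl⟩ := Language.mem_mul.1 hw
    obtain ⟨a, ha⟩ := exists_parse_iff.2 hu.1
    obtain ⟨b, hb⟩ := exists_parse_iff.2 (ih hv)
    exact (ha.append hb).derives

theorem weight_eq_zero_of_not_productive {ω : SizedWord g}
    (h : ¬ Productive g (ω.map Prod.fst)) : weight wt g ω = 0 :=
  finsum_mem_eq_zero_of_forall_eq_zero fun w hw =>
    (h ⟨w, derives_of_mem_sizedLanguage hw⟩).elim

theorem weight_update [Finite T] (r : ContextFreeRule T g.NT) (α β X : SizedWord g) (m : ℕ)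
    (h : ntWeight wt g r.input m ≠ 0) :
    weight wt g (α ++ X ++ β) =
      weight wt g (α ++ [(Symbol.nonterminal r.input, m)] ++ β) * weight wt g X
        / ntWeight wt g r.input m := by
  rw [weight_append, weight_append, weight_append, weight_append]
  change _ = weight wt g α * ntWeight wt g r.input m * _ * _ / _
  field_simp

theorem weight_output_eq_zero [Finite T] (hwt : ∀ t, 0 ≤ wt t) {r : ContextFreeRule T g.NT}
    (hr : r ∈ g.rules) {X : SizedWord g} {m : ℕ} (hX : X.map Prod.fst = r.output)
    (hm : totalLength X = m) (h : ntWeight wt g r.input m = 0) : weight wt g X = 0 := by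
  rw [ntWeight, weight_singleton] at h
  refine languageWeight_eq_zero_of_subset hwt (finite_formLanguage _ _) h fun w hw => ⟨?_, ?_⟩
  · refine ContextFreeGrammar.Produces.trans_derives ⟨r, hr, .input_output⟩ ?_
    exact hX ▸ derives_of_mem_sizedLanguage hw
  · rw [length_of_mem_sizedLanguage g X w hw, hm]

/-! ### The polynomial system of the generating functions -/

theorem coeff_formSeries_nonterminal (N : g.NT) (m : ℕ) :
    (formSeries wt g [Symbol.nonterminal N]).coeff m = ntWeight wt g N m := by
  rw [formSeries, PowerSeries.coeff_mk, ntWeight, weight_singleton]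

theorem formSeries_eq_zero {ω : List (Symbol T g.NT)} (h : ¬ Productive g ω) :
    formSeries wt g ω = 0 := by
  ext m
  rw [formSeries, PowerSeries.coeff_mk, map_zero]
  exact finsum_mem_eq_zero_of_forall_eq_zero fun w hw => (h ⟨w, hw.1⟩).elim

theorem formSeries_nil : formSeries wt g [] = 1 := by
  ext m
  rw [formSeries, PowerSeries.coeff_mk, PowerSeries.coeff_one]
  have : ∀ w : List T, w ∈ formLanguage g [] m ↔ w = [] ∧ m = 0 := by
    intro w
    have : g.Derives [] (w.map Symbol.terminal) ↔ w = [] := by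
      rw [← exists_parse_iff]
      constructor
      · rintro ⟨rs, h⟩; cases h; rfl
      · rintro rfl; exact ⟨[], .nil⟩
    refine (and_congr_left fun _ => this).trans (and_congr_right ?_)
    rintro rfl
    exact eq_comm
  split_ifs with hm
  · have e : formLanguage g [] m = ({[]} : Set (List T)) := by
      ext w; rw [this]; exact and_iff_left hm
    rw [e]
    exact (languageWeight_singleton _).trans (by simp [wordWeight])
  · exact finsum_mem_eq_zero_of_forall_eq_zero fun w hw => (hm ((this w).1 hw).2).elim

theorem formSeries_terminal (t : T) :
    formSeries wt g [Symbol.terminal t] = PowerSeries.C (wt t) * PowerSeries.X := by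
  ext m
  rw [formSeries, PowerSeries.coeff_mk, languageWeight_formLanguage_terminal,
    PowerSeries.coeff_C_mul, PowerSeries.coeff_X]
  simp

/-- Concatenation of unambiguous forms multiplies the generating functions. -/
theorem formSeries_append [Finite T] {ω₁ ω₂ : List (Symbol T g.NT)}
    (h : UniqueParse g (ω₁ ++ ω₂)) :
    formSeries wt g (ω₁ ++ ω₂) = formSeries wt g ω₁ * formSeries wt g ω₂ := by
  have hinj : ∀ u u' v v' : List T, g.Derives ω₁ (u.map Symbol.terminal) →
      g.Derives ω₁ (u'.map Symbol.terminal) → g.Derives ω₂ (v.map Symbol.terminal) →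
      g.Derives ω₂ (v'.map Symbol.terminal) → u ++ v = u' ++ v' → u = u' ∧ v = v' := by
    intro u u' v v' hu hu' hv hv' he
    obtain ⟨a, ha⟩ := exists_parse_iff.2 hu
    obtain ⟨a', ha'⟩ := exists_parse_iff.2 hu'
    obtain ⟨b, hb⟩ := exists_parse_iff.2 hv
    obtain ⟨b', hb'⟩ := exists_parse_iff.2 hv'
    obtain ⟨-, -, rfl⟩ := ha.prefix_free ha'
      (h _ _ _ (ha.append hb) (he ▸ ha'.append hb'))
    exact ⟨rfl, List.append_cancel_left he⟩
  ext m
  rw [PowerSeries.coeff_mul]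
  simp only [formSeries, PowerSeries.coeff_mk]
  have hU : formLanguage g (ω₁ ++ ω₂) m =
      ⋃ p ∈ (↑(Finset.HasAntidiagonal.antidiagonal m) : Set (ℕ × ℕ)),
        (show Set (List T) from formLanguage g ω₁ p.1 * formLanguage g ω₂ p.2) := by
    ext w
    refine Iff.trans ?_ Set.mem_iUnion₂.symm
    constructor
    · rintro ⟨hd, hl⟩
      obtain ⟨rs, hrs⟩ := exists_parse_iff.2 hd
      obtain ⟨a, b, u, v, -, rfl, h1, h2⟩ := hrs.exists_of_append
      exact ⟨(u.length, v.length), by simpa using hl,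
        Language.mem_mul.2 ⟨u, ⟨h1.derives, rfl⟩, v, ⟨h2.derives, rfl⟩, rfl⟩⟩
    · rintro ⟨p, hp, hw⟩
      obtain ⟨u, hu, v, hv, rfl⟩ := Language.mem_mul.1 hw
      obtain ⟨a, ha⟩ := exists_parse_iff.2 hu.1
      obtain ⟨b, hb⟩ := exists_parse_iff.2 hv.1
      refine ⟨(ha.append hb).derives, ?_⟩
      rw [List.length_append, hu.2, hv.2]
      simpa using hp
  rw [hU]
  refine (finsum_mem_biUnion ?_ (Finset.finite_toSet _) ?_).trans ?_
  · intro p _ q _ hpq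
    refine Set.disjoint_left.2 fun w hw hw' => hpq ?_
    obtain ⟨u, hu, v, hv, rfl⟩ := Language.mem_mul.1 hw
    obtain ⟨u', hu', v', hv', he⟩ := Language.mem_mul.1 hw'
    obtain ⟨rfl, rfl⟩ := hinj _ _ _ _ hu'.1 hu.1 hv'.1 hv.1 he
    exact Prod.ext (hu.2.symm.trans hu'.2) (hv.2.symm.trans hv'.2)
  · intro p _
    exact Set.Finite.image2 _ (finite_formLanguage _ _) (finite_formLanguage _ _)
  · rw [finsum_mem_coe_finset]
    refine Finset.sum_congr rfl fun p _ => ?_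
    exact languageWeight_mul (finite_formLanguage _ _) (finite_formLanguage _ _)
      fun u hu u' hu' v hv v' hv' => hinj u u' v v' hu.1 hu'.1 hv.1 hv'.1

open Classical in
/-- The words of an unambiguous non-terminal are split up by the first rule of their parses. -/
theorem formSeries_nonterminal [Finite T] {N : g.NT}
    (h : UniqueParse g [Symbol.nonterminal N]) :
    formSeries wt g [Symbol.nonterminal N] =
      ∑ r ∈ g.rules with r.input = N, formSeries wt g r.output := by
  ext m
  rw [map_sum]
  simp only [formSeries, PowerSeries.coeff_mk]
  have hU : formLanguage g [Symbol.nonterminal N] m =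
      ⋃ r ∈ (↑(g.rules.filter fun r => r.input = N) : Set (ContextFreeRule T g.NT)),
        (show Set (List T) from formLanguage g r.output m) := by
    ext w
    refine Iff.trans ?_ Set.mem_iUnion₂.symm
    constructor
    · rintro ⟨hd, hl⟩
      obtain ⟨rs, hrs⟩ := exists_parse_iff.2 hd
      obtain ⟨r, hr, rs', hN, -, hp⟩ := Parse.singleton_nonterminal_iff.1 hrs
      exact ⟨r, Finset.mem_coe.2 (Finset.mem_filter.2 ⟨hr, hN⟩), hp.derives, hl⟩
    · rintro ⟨r, hrN, hw⟩
      obtain ⟨hr, rfl⟩ := Finset.mem_filter.1 (Finset.mem_coe.1 hrN)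
      exact ⟨ContextFreeGrammar.Produces.trans_derives ⟨r, hr, .input_output⟩ hw.1, hw.2⟩
  rw [hU]
  refine (finsum_mem_biUnion ?_ (Finset.finite_toSet _) ?_).trans ?_
  · intro r hr r' hr' hne
    obtain ⟨hr, hN⟩ : r ∈ g.rules ∧ r.input = N := Finset.mem_filter.1 hr
    obtain ⟨hr', hN'⟩ : r' ∈ g.rules ∧ r'.input = N := Finset.mem_filter.1 hr'
    refine Set.disjoint_left.2 fun w hw hw' => hne ?_
    obtain ⟨a, ha⟩ := exists_parse_iff.2 hw.1
    obtain ⟨a', ha'⟩ := exists_parse_iff.2 hw'.1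
    have := h w _ _ (Parse.singleton_nonterminal_iff.2 ⟨r, hr, a, hN, rfl, ha⟩)
      (Parse.singleton_nonterminal_iff.2 ⟨r', hr', a', hN', rfl, ha'⟩)
    exact (List.cons.inj this).1
  · exact fun r _ => finite_formLanguage _ _
  · rw [finsum_mem_coe_finset]
    rfl

/-- Non-terminals in right-hand sides do not derive the empty word, so that their generating
functions have no constant term. -/
theorem IsCNF.constantCoeff_formSeries (hcnf : IsCNF g) {r : ContextFreeRule T g.NT}
    {x : Symbol T g.NT} (hr : r ∈ g.rules) (hx : x ∈ r.output) :
    PowerSeries.constantCoeff (formSeries wt g [x]) = 0 := by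
  rw [← PowerSeries.coeff_zero_eq_constantCoeff_apply, formSeries, PowerSeries.coeff_mk]
  refine finsum_mem_eq_zero_of_forall_eq_zero fun w hw => ?_
  obtain ⟨hd, hl⟩ := hw
  rw [List.length_eq_zero_iff] at hl
  subst hl
  exact (hcnf.not_derives_nil hr hx hd).elim

/-! ### Solutions of polynomial systems with invertible Jacobian are algebraic -/

theorem derivation_aeval {K A M ι : Type*} [CommRing K] [CommRing A] [Algebra K A]
    [AddCommGroup M] [Module K M] [Module A M] [IsScalarTower K A M] [Fintype ι]
    (D : Derivation K A M) (e : ι → A) (p : MvPolynomial ι K) :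
    D (MvPolynomial.aeval e p) =
      ∑ j, MvPolynomial.aeval e (MvPolynomial.pderiv j p) • D (e j) := by
  classical
  induction p using MvPolynomial.induction_on with
  | C a => simp
  | add p q hp hq => simp [hp, hq, add_smul, Finset.sum_add_distrib]
  | mul_X p i hp =>
    simp only [map_mul, MvPolynomial.aeval_X, Derivation.leibniz, hp, map_add, smul_eq_mul,
      add_smul, Finset.sum_add_distrib, Finset.smul_sum, MvPolynomial.pderiv_X, smul_smul]
    congr 1
    rw [Finset.sum_eq_single i]
    · simp
    · intro j _ hj
      simp [hj.symm]
    · simp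

/-- The differentials of the components of a solution satisfy a homogeneous linear system whose
matrix is invertible, so the extension generated by the solution has no differentials. -/
theorem finiteDimensional_adjoin_of_det_ne_zero {K L : Type} [Field K] [CharZero K] [Field L]
    [Algebra K L] {ι : Type} [Fintype ι] [DecidableEq ι] (f : ι → L)
    (Φ : ι → MvPolynomial ι K) (hΦ : ∀ i, MvPolynomial.aeval f (Φ i) = f i)
    (hdet : (1 - Matrix.of fun i j =>
      MvPolynomial.aeval f (MvPolynomial.pderiv j (Φ i))).det ≠ 0) :
    FiniteDimensional K (IntermediateField.adjoin K (Set.range f)) := by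
  set E := IntermediateField.adjoin K (Set.range f)
  let e : ι → E := fun i => ⟨f i, IntermediateField.subset_adjoin K _ ⟨i, rfl⟩⟩
  have hfe : ∀ p : MvPolynomial ι K, algebraMap E L (MvPolynomial.aeval e p) =
      MvPolynomial.aeval f p := fun p => by
    rw [← MvPolynomial.aeval_algebraMap_apply]; rfl
  have : Algebra.EssFiniteType K E := IntermediateField.essFiniteType_iff.2
    (IntermediateField.fg_adjoin_of_finite (Set.finite_range f))
  let D := KaehlerDifferential.D K E
  have hD : ∀ i, D (e i) = 0 := by
    intro i
    rw [← Module.forall_dual_apply_eq_zero_iff E]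
    intro l
    by_contra hne
    refine hdet (Matrix.exists_mulVec_eq_zero_iff.1
      ⟨fun j => algebraMap E L (l (D (e j))), fun h => hne ?_, ?_⟩)
    · exact (algebraMap E L).injective ((congrFun h i).trans (map_zero _).symm)
    · ext j
      have h1 : MvPolynomial.aeval e (Φ j) = e j :=
        (algebraMap E L).injective ((hfe _).trans (hΦ j))
      have h2 := congrArg (fun x => algebraMap E L (l x)) (derivation_aeval D e (Φ j))
      rw [h1] at h2
      simp only [map_sum, map_smul, smul_eq_mul, map_mul, hfe] at h2
      rw [Matrix.sub_mulVec, Matrix.one_mulVec, Pi.sub_apply, Pi.zero_apply, sub_eq_zero, h2]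
      rfl
  have hD0 : ∀ x (hx : x ∈ E), D ⟨x, hx⟩ = 0 := by
    intro x hx
    induction hx using IntermediateField.adjoin_induction with
    | mem x h =>
      obtain ⟨i, rfl⟩ := h
      exact hD i
    | algebraMap x => exact D.map_algebraMap x
    | add x y hx hy h1 h2 =>
      have : D (⟨x, hx⟩ + ⟨y, hy⟩) = 0 := by rw [map_add, h1, h2, add_zero]
      exact this
    | inv x hx h1 =>
      have : D (⟨x, hx⟩⁻¹) = 0 := by rw [Derivation.leibniz_inv, h1, smul_zero]
      exact this
    | mul x y hx hy h1 h2 =>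
      have : D (⟨x, hx⟩ * ⟨y, hy⟩) = 0 := by rw [Derivation.leibniz, h1, h2]; simp
      exact this
  have : Algebra.FormallyUnramified K E := by
    refine ⟨(Submodule.subsingleton_iff E).1 (subsingleton_of_bot_eq_top ?_)⟩
    rw [← KaehlerDifferential.span_range_derivation K E, eq_comm, Submodule.span_eq_bot]
    rintro _ ⟨⟨x, hx⟩, rfl⟩
    exact hD0 x hx
  exact Algebra.FormallyUnramified.finite_of_free K E

/-! ### Algebraic power series are holonomic -/

/-- The Euler derivation `X · d/dX`. -/
noncomputable def euler : Derivation ℝ (PowerSeries ℝ) (PowerSeries ℝ) :=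
  (PowerSeries.X : PowerSeries ℝ) • PowerSeries.derivative ℝ

theorem coeff_euler (f : PowerSeries ℝ) (m : ℕ) : (euler f).coeff m = m * f.coeff m := by
  change (PowerSeries.X * PowerSeries.derivative ℝ f).coeff m = _
  cases m with
  | zero => simp
  | succ m =>
    rw [PowerSeries.coeff_succ_X_mul, PowerSeries.coeff_derivative]
    push_cast
    ring

theorem coeff_iterate_euler (f : PowerSeries ℝ) (k m : ℕ) :
    (euler^[k] f).coeff m = (m : ℝ) ^ k * f.coeff m := by
  induction k with
  | zero => simp
  | succ k ih => rw [Function.iterate_succ_apply', coeff_euler, ih]; ring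

theorem euler_coe (p : ℝ[X]) :
    euler (algebraMap ℝ[X] (PowerSeries ℝ) p) =
      algebraMap ℝ[X] (PowerSeries ℝ) (Polynomial.X * Polynomial.derivative p) := by
  change PowerSeries.X * PowerSeries.derivative ℝ (p : PowerSeries ℝ) = _
  rw [PowerSeries.derivative_coe, map_mul]
  congr 1
  exact (Polynomial.coe_X).symm

theorem algebraMap_polynomial_injective :
    Function.Injective (algebraMap ℝ[X] (PowerSeries ℝ)) :=
  Polynomial.coe_injective ℝ

/-- The chain rule for a polynomial with coefficients in `ℝ[X]` at a power series. -/
theorem exists_euler_aeval (f : PowerSeries ℝ) (P : ℝ[X][X]) :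
    ∃ Q : ℝ[X][X], euler (Polynomial.aeval f P) =
      Polynomial.aeval f Q + Polynomial.aeval f (Polynomial.derivative P) * euler f := by
  induction P using Polynomial.induction_on' with
  | add P P' h h' =>
    obtain ⟨Q, hQ⟩ := h
    obtain ⟨Q', hQ'⟩ := h'
    exact ⟨Q + Q', by simp only [map_add, hQ, hQ']; ring⟩
  | monomial n a =>
    refine ⟨Polynomial.monomial n (Polynomial.X * Polynomial.derivative a), ?_⟩
    simp only [Polynomial.aeval_monomial, Polynomial.derivative_monomial, Derivation.leibniz,
      Derivation.leibniz_pow, euler_coe, smul_eq_mul, nsmul_eq_mul, map_mul, map_natCast]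
    ring

theorem algebraMap_aeval_mem {K L : Type} [Field K] [Field L] [Algebra ℝ[X] K]
    [Algebra K L] [Algebra (PowerSeries ℝ) L] [Algebra ℝ[X] L] [IsScalarTower ℝ[X] K L]
    [IsScalarTower ℝ[X] (PowerSeries ℝ) L] (E : IntermediateField K L) {f : PowerSeries ℝ}
    (hf : algebraMap _ L f ∈ E) (P : ℝ[X][X]) :
    algebraMap _ L (Polynomial.aeval f P) ∈ E := by
  rw [← Polynomial.aeval_algebraMap_apply, Polynomial.aeval_eq_sum_range]
  refine sum_mem fun i _ => ?_
  rw [Algebra.smul_def, IsScalarTower.algebraMap_apply ℝ[X] K L]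
  exact mul_mem (E.algebraMap_mem _) (pow_mem hf i)

/-- An algebraic power series is a simple root of some equation. -/
theorem exists_aeval_eq_zero_derivative_ne_zero {f : PowerSeries ℝ} (hf : IsAlgebraic ℝ[X] f) :
    ∃ P : ℝ[X][X], Polynomial.aeval f P = 0 ∧
      Polynomial.aeval f (Polynomial.derivative P) ≠ 0 := by
  obtain ⟨P, hP0, hP⟩ := hf
  induction hn : P.natDegree using Nat.strong_induction_on generalizing P with
  | _ n ih =>
  by_cases h : Polynomial.aeval f (Polynomial.derivative P) = 0
  · have hd : P.natDegree ≠ 0 := by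
      intro hd
      rw [Polynomial.eq_C_of_natDegree_eq_zero hd, Polynomial.aeval_C,
        map_eq_zero_iff _ algebraMap_polynomial_injective] at hP
      rw [Polynomial.eq_C_of_natDegree_eq_zero hd, hP, Polynomial.C_0] at hP0
      exact hP0 rfl
    exact ih _ (hn ▸ Polynomial.natDegree_derivative_lt hd) _
      (fun h0 => hd (Polynomial.derivative_eq_zero.1 h0)) h rfl
  · exact ⟨P, hP, h⟩

/-- Differentiation of a separable equation shows that the derivative of an algebraic power
series is a rational function of it. -/
theorem algebraMap_euler_mem {K L : Type} [Field K] [Field L] [Algebra ℝ[X] K]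
    [IsFractionRing ℝ[X] K] [Algebra K L] [Algebra (PowerSeries ℝ) L] [Algebra ℝ[X] L]
    [IsScalarTower ℝ[X] K L] [IsScalarTower ℝ[X] (PowerSeries ℝ) L]
    (hinj : Function.Injective (algebraMap (PowerSeries ℝ) L)) (E : IntermediateField K L)
    [Algebra.IsAlgebraic K E] {f : PowerSeries ℝ} (hf : algebraMap _ L f ∈ E) :
    algebraMap _ L (euler f) ∈ E := by
  have halg : IsAlgebraic ℝ[X] f := by
    have h1 : IsAlgebraic K (algebraMap _ L f) := by
      have := Algebra.IsAlgebraic.isAlgebraic (R := K) (⟨_, hf⟩ : E)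
      exact (isAlgebraic_algebraMap_iff (algebraMap E L).injective).2 this
    have h2 : IsAlgebraic ℝ[X] (algebraMap _ L f) :=
      (IsFractionRing.isAlgebraic_iff ℝ[X] K L).2 h1
    exact (isAlgebraic_algebraMap_iff hinj).1 h2
  obtain ⟨P, hP, hP'⟩ := exists_aeval_eq_zero_derivative_ne_zero halg
  obtain ⟨Q, hQ⟩ := exists_euler_aeval f P
  rw [hP, map_zero] at hQ
  have hne : algebraMap _ L (Polynomial.aeval f (Polynomial.derivative P)) ≠ 0 :=
    (map_ne_zero_iff _ hinj).2 hP'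
  have key : algebraMap _ L (euler f) = -algebraMap _ L (Polynomial.aeval f Q) /
      algebraMap _ L (Polynomial.aeval f (Polynomial.derivative P)) := by
    rw [eq_div_iff hne, ← map_mul, ← map_neg]
    congr 1
    linear_combination -hQ
  rw [key]
  exact div_mem (neg_mem (algebraMap_aeval_mem E hf Q)) (algebraMap_aeval_mem E hf _)

/-- A linear differential equation in the Euler derivation is a recurrence for the coefficients:
the coefficient of `X ^ (m + D)` in `q k * euler^[k] f` involves only the coefficients of `f` with
indices in `[m, m + D]` once `D` bounds the degrees. -/
theorem isHolonomic_of_euler {f : PowerSeries ℝ} {d : ℕ} {q : ℕ → ℝ[X]}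
    (hq : ∃ k ∈ Finset.range d, q k ≠ 0)
    (h : ∑ k ∈ Finset.range d, algebraMap ℝ[X] (PowerSeries ℝ) (q k) * euler^[k] f = 0) :
    IsHolonomic fun m => f.coeff m := by
  classical
  let D := (Finset.range d).sup fun k => (q k).natDegree
  have hD : ∀ k ∈ Finset.range d, ∀ i, D < i → (q k).coeff i = 0 := fun k hk i hi =>
    Polynomial.coeff_eq_zero_of_natDegree_lt
      ((Finset.le_sup (f := fun k => (q k).natDegree) hk).trans_lt hi)
  let Q : ℕ → ℝ[X] := fun i => ∑ k ∈ Finset.range d, Polynomial.monomial k ((q k).coeff i)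
  have hQ : ∀ i (x : ℝ), (Q i).eval x = ∑ k ∈ Finset.range d, (q k).coeff i * x ^ k := by
    intro i x
    simp only [Q, Polynomial.eval_finsetSum, Polynomial.eval_monomial]
  let P : ℕ → ℝ[X] := fun j => (Q (D - j)).comp (Polynomial.X + Polynomial.C (j : ℝ))
  have hrec : ∀ m : ℕ, ∑ j ∈ Finset.range (D + 1), (P j).eval (m : ℝ) * f.coeff (m + j) = 0 := by
    intro m
    have hc := congrArg (PowerSeries.coeff (m + D)) h
    rw [map_sum, map_zero] at hc
    have hk : ∀ k ∈ Finset.range d,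
        (algebraMap ℝ[X] (PowerSeries ℝ) (q k) * euler^[k] f).coeff (m + D) =
          ∑ i ∈ Finset.range (D + 1), (q k).coeff i * (((m + D - i : ℕ) : ℝ) ^ k *
            f.coeff (m + D - i)) := by
      intro k hk
      rw [PowerSeries.coeff_mul, Finset.Nat.sum_antidiagonal_eq_sum_range_succ_mk]
      simp only [coeff_iterate_euler]
      have hsub : Finset.range (D + 1) ⊆ Finset.range (m + D).succ :=
        Finset.range_subset_range.2 (by omega)
      refine (Finset.sum_subset hsub ?_).symm.trans ?_
      · intro i _ hi
        have : (q k).coeff i = 0 := hD k hk i (by simpa using hi)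
        change (q k : PowerSeries ℝ).coeff i * _ = 0
        rw [Polynomial.coeff_coe, this, zero_mul]
      · refine Finset.sum_congr rfl fun i _ => ?_
        change (q k : PowerSeries ℝ).coeff i * _ = _
        rw [Polynomial.coeff_coe]
    rw [Finset.sum_congr rfl hk, Finset.sum_comm, ← Finset.sum_range_reflect] at hc
    rw [← hc]
    refine Finset.sum_congr rfl fun j hj => ?_
    have hj : j ≤ D := Nat.lt_succ_iff.1 (Finset.mem_range.1 hj)
    have e1 : D + 1 - 1 - j = D - j := by omega
    have e2 : m + D - (D - j) = m + j := by omega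
    simp only [P, Polynomial.eval_comp, Polynomial.eval_add, Polynomial.eval_X,
      Polynomial.eval_C, hQ, e1, e2, Finset.sum_mul]
    refine Finset.sum_congr rfl fun k _ => ?_
    push_cast
    ring
  have hne : ∃ j ≤ D, P j ≠ 0 := by
    obtain ⟨k, hk, hqk⟩ := hq
    have hkD : (q k).natDegree ≤ D := Finset.le_sup (f := fun k => (q k).natDegree) hk
    refine ⟨D - (q k).natDegree, by omega, fun h0 => ?_⟩
    have h1 : Q (q k).natDegree = 0 := by
      have e : D - (D - (q k).natDegree) = (q k).natDegree := by omega
      simp only [P, e] at h0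
      exact (Polynomial.comp_X_add_C_eq_zero_iff).1 h0
    have h2 := congrArg (fun p => Polynomial.coeff p k) h1
    simp only [Q, Polynomial.finsetSum_coeff, Polynomial.coeff_monomial,
      Finset.sum_ite_eq', if_pos hk, Polynomial.coeff_zero] at h2
    exact hqk (Polynomial.leadingCoeff_eq_zero.1 h2)
  obtain ⟨j, hj, hPj⟩ := hne
  refine ⟨Nat.findGreatest (fun j => P j ≠ 0) D, P,
    Nat.findGreatest_spec (P := fun j => P j ≠ 0) hj hPj, fun m => ?_⟩
  rw [← hrec m]
  refine Finset.sum_subset (Finset.range_subset_range.2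
    (Nat.succ_le_succ (Nat.findGreatest_le D))) fun i hi hi' => ?_
  have : ¬ P i ≠ 0 := Nat.findGreatest_is_greatest (P := fun j => P j ≠ 0) (n := D)
    (by simpa using hi') (by simpa [Nat.lt_succ_iff] using hi)
  rw [not_not.1 this, Polynomial.eval_zero, zero_mul]

/-- The components of a power series solution of a polynomial system over `ℝ[X]` with invertible
Jacobian are holonomic. -/
theorem isHolonomic_of_polynomial_system {ι : Type} [Fintype ι] [DecidableEq ι]
    (F : ι → PowerSeries ℝ) (Φ : ι → MvPolynomial ι ℝ[X])
    (hΦ : ∀ i, MvPolynomial.aeval F (Φ i) = F i)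
    (hdet : (1 - Matrix.of fun i j =>
      MvPolynomial.aeval F (MvPolynomial.pderiv j (Φ i))).det ≠ 0) (i : ι) :
    IsHolonomic fun m => (F i).coeff m := by
  let L := FractionRing (PowerSeries ℝ)
  let K := FractionRing ℝ[X]
  have : FaithfulSMul ℝ[X] (PowerSeries ℝ) :=
    (faithfulSMul_iff_algebraMap_injective _ _).2 algebraMap_polynomial_injective
  let _ : Algebra K L := FractionRing.liftAlgebra ℝ[X] L
  have : IsScalarTower ℝ[X] K L := FractionRing.isScalarTower_liftAlgebra ℝ[X] L
  have hinj : Function.Injective (algebraMap (PowerSeries ℝ) L) :=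
    IsFractionRing.injective (PowerSeries ℝ) L
  let f : ι → L := fun i => algebraMap _ L (F i)
  have hmap : ∀ p : MvPolynomial ι ℝ[X], MvPolynomial.aeval f (p.map (algebraMap ℝ[X] K)) =
      algebraMap _ L (MvPolynomial.aeval F p) := fun p => by
    rw [MvPolynomial.aeval_map_algebraMap, ← MvPolynomial.aeval_algebraMap_apply]
    rfl
  have hfin : FiniteDimensional K (IntermediateField.adjoin K (Set.range f)) := by
    refine finiteDimensional_adjoin_of_det_ne_zero f
      (fun i => (Φ i).map (algebraMap ℝ[X] K)) (fun i => ?_) ?_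
    · rw [hmap, hΦ]
    · have : (1 - Matrix.of fun i j => MvPolynomial.aeval f (MvPolynomial.pderiv j
            ((Φ i).map (algebraMap ℝ[X] K)))) =
          (algebraMap (PowerSeries ℝ) L).mapMatrix (1 - Matrix.of fun i j =>
            MvPolynomial.aeval F (MvPolynomial.pderiv j (Φ i))) := by
        rw [map_sub, map_one]
        congr 1
        ext a b
        simp [MvPolynomial.pderiv_map, hmap]
      rw [this, ← RingHom.map_det]
      exact (map_ne_zero_iff _ hinj).2 hdet
  set E := IntermediateField.adjoin K (Set.range f)
  have hmem : ∀ k, algebraMap _ L (euler^[k] (F i)) ∈ E := by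
    intro k
    induction k with
    | zero => exact IntermediateField.subset_adjoin K _ ⟨i, rfl⟩
    | succ k ih =>
      rw [Function.iterate_succ_apply']
      exact algebraMap_euler_mem hinj E ih
  let d := Module.finrank K E + 1
  let v : Fin d → E := fun k => ⟨_, hmem k⟩
  have hdep : ¬ LinearIndependent ℝ[X] v := by
    rw [LinearIndependent.iff_fractionRing ℝ[X] K]
    intro h
    have := h.fintype_card_le_finrank
    simp [d] at this
  obtain ⟨c, hc, k, hk⟩ := Fintype.not_linearIndependent_iff.1 hdep
  let q : ℕ → ℝ[X] := fun k => if h : k < d then c ⟨k, h⟩ else 0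
  refine isHolonomic_of_euler (d := d) (q := q)
    ⟨k, Finset.mem_range.2 k.2, by simpa [q] using hk⟩ (hinj ?_)
  rw [map_zero, map_sum, Finset.sum_range]
  have hc' := congrArg (algebraMap E L) hc
  rw [map_zero, map_sum] at hc'
  rw [← hc']
  refine Finset.sum_congr rfl fun k _ => ?_
  have e : c k • v k = algebraMap ℝ[X] K (c k) • v k := (algebraMap_smul K (c k) (v k)).symm
  rw [e, Algebra.smul_def, map_mul, map_mul, ← IsScalarTower.algebraMap_apply K E L,
    ← IsScalarTower.algebraMap_apply ℝ[X] K L, ← IsScalarTower.algebraMap_apply ℝ[X] _ L]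
  simp only [q, k.2, dif_pos]
  rfl

/-! ### The weights of a useful non-terminal are holonomic -/

/-- The right-hand side of a rule contributes a polynomial in the generating functions of the
useful non-terminals; only a rule `N → A` gives it a linear part at `X = 0`. -/
theorem IsCNF.exists_mvPolynomial [Finite T] (hcnf : IsCNF g) {r : ContextFreeRule T g.NT}
    (hr : r ∈ g.rules) (hu : Useful g r.input)
    (huniq : UniqueParse g [Symbol.nonterminal r.input]) :
    ∃ p : MvPolynomial {N // Useful g N} ℝ[X],
      MvPolynomial.aeval (fun i => formSeries wt g [Symbol.nonterminal i.1]) p =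
        formSeries wt g r.output ∧
      ∀ A, PowerSeries.constantCoeff (MvPolynomial.aeval
        (fun i : {N // Useful g N} => formSeries wt g [Symbol.nonterminal i.1])
          (MvPolynomial.pderiv A p)) ≠ 0 → r.output = [Symbol.nonterminal A.1] := by
  classical
  by_cases hp : Productive g r.output
  swap
  · exact ⟨0, by simp [formSeries_eq_zero hp], by simp⟩
  rcases hcnf r hr with ⟨A, B, ho⟩ | ⟨A, ho⟩ | ⟨t, ho⟩ | ⟨ho, -⟩
  · have hA : Useful g A := hu.of_rule hr hp (by simp [ho])
    have hB : Useful g B := hu.of_rule hr hp (by simp [ho])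
    have hA0 := hcnf.constantCoeff_formSeries (wt := wt) (x := .nonterminal A) hr (by simp [ho])
    have hB0 := hcnf.constantCoeff_formSeries (wt := wt) (x := .nonterminal B) hr (by simp [ho])
    refine ⟨MvPolynomial.X ⟨A, hA⟩ * MvPolynomial.X ⟨B, hB⟩, ?_, fun C hC => (hC ?_).elim⟩
    · have h := formSeries_append (wt := wt) (ω₁ := [.nonterminal A]) (ω₂ := [.nonterminal B])
        (by simpa [ho] using huniq.output hr)
      simp only [map_mul, MvPolynomial.aeval_X, ho]
      exact h.symm
    · simp [Derivation.leibniz, MvPolynomial.aeval_X, hA0, hB0]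
  · have hA : Useful g A := hu.of_rule hr hp (by simp [ho])
    refine ⟨MvPolynomial.X ⟨A, hA⟩, by simp [ho], fun C hC => ?_⟩
    by_cases hCA : C = ⟨A, hA⟩
    · rw [hCA, ho]
    · rw [MvPolynomial.pderiv_X_of_ne (Ne.symm hCA)] at hC
      simp at hC
  · refine ⟨MvPolynomial.C (Polynomial.C (wt t) * Polynomial.X), ?_, by simp⟩
    rw [ho, formSeries_terminal, MvPolynomial.aeval_C]
    change ((Polynomial.C (wt t) * Polynomial.X : ℝ[X]) : PowerSeries ℝ) = _
    rw [Polynomial.coe_mul, Polynomial.coe_C, Polynomial.coe_X]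
  · exact ⟨1, by simp [ho, formSeries_nil], by simp⟩

/-- A matrix supported on an acyclic relation has no eigenvalue one. -/
theorem det_one_sub_ne_zero_of_acyclic {ι : Type} [Fintype ι] [DecidableEq ι]
    (M : Matrix ι ι ℝ) (R : ι → ι → Prop) (hM : ∀ i j, M i j ≠ 0 → R i j)
    (hR : ∀ i, ¬ Relation.TransGen R i i) : (1 - M).det ≠ 0 := by
  intro h
  obtain ⟨v, hv, h⟩ := Matrix.exists_mulVec_eq_zero_iff.2 h
  rw [Matrix.sub_mulVec, Matrix.one_mulVec, sub_eq_zero] at h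
  refine hv (funext fun i => ?_)
  have : IsTrans ι fun j i => Relation.TransGen R i j := ⟨fun _ _ _ h1 h2 => h2.trans h1⟩
  have : Std.Irrefl fun j i => Relation.TransGen R i j := ⟨hR⟩
  have hwf := Finite.wellFounded_of_trans_of_irrefl fun j i => Relation.TransGen R i j
  induction i using hwf.induction with
  | _ i ih =>
  rw [h]
  refine Finset.sum_eq_zero fun j _ => ?_
  by_cases hij : M i j = 0
  · simp [hij]
  · rw [ih j (.single (hM i j hij))]
    simp

theorem Unambiguous.isHolonomic_ntWeight [Finite T] [Finite g.NT] (hcnf : IsCNF g)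
    {φ : DerivationPolicy g} (hunamb : Unambiguous φ) {N : g.NT} (hN : Useful g N) :
    IsHolonomic (ntWeight wt g N) := by
  classical
  let ι := {N // Useful g N}
  let _ : Fintype ι := Fintype.ofFinite ι
  let F : ι → PowerSeries ℝ := fun i => formSeries wt g [Symbol.nonterminal i.1]
  have hp : ∀ r : ContextFreeRule T g.NT, ∃ p : MvPolynomial ι ℝ[X],
      r ∈ g.rules → Useful g r.input → MvPolynomial.aeval F p = formSeries wt g r.output ∧
      ∀ A, PowerSeries.constantCoeff (MvPolynomial.aeval F (MvPolynomial.pderiv A p)) ≠ 0 →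
        r.output = [Symbol.nonterminal A.1] := by
    intro r
    by_cases h : r ∈ g.rules ∧ Useful g r.input
    · obtain ⟨p, hp⟩ := hcnf.exists_mvPolynomial (wt := wt) h.1 h.2 (hunamb.uniqueParse h.2)
      exact ⟨p, fun _ _ => hp⟩
    · exact ⟨0, fun h1 h2 => (h ⟨h1, h2⟩).elim⟩
  choose p hp using hp
  let Φ : ι → MvPolynomial ι ℝ[X] := fun i => ∑ r ∈ g.rules with r.input = i.1, p r
  have hΦ : ∀ i, MvPolynomial.aeval F (Φ i) = F i := by
    intro i
    rw [map_sum]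
    refine Eq.trans (Finset.sum_congr rfl fun r hr => ?_)
      (formSeries_nonterminal (hunamb.uniqueParse i.2)).symm
    obtain ⟨hr, hi⟩ := Finset.mem_filter.1 hr
    exact (hp r hr (hi ▸ i.2)).1
  have h := isHolonomic_of_polynomial_system F Φ hΦ ?_ ⟨N, hN⟩
  · have e : (fun m => (F ⟨N, hN⟩).coeff m) = ntWeight wt g N :=
      funext fun m => coeff_formSeries_nonterminal N m
    exact e ▸ h
  · intro h0
    -- at `X = 0` only the rules `N → A` survive in the Jacobian
    have h1 := congrArg (PowerSeries.constantCoeff (R := ℝ)) h0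
    rw [map_zero, RingHom.map_det, map_sub, map_one] at h1
    refine det_one_sub_ne_zero_of_acyclic _ (fun A B : ι => ∃ r ∈ g.rules, r.input = A.1 ∧
      r.output = [Symbol.nonterminal B.1]) ?_ ?_ h1
    · intro A B hAB
      simp only [RingHom.mapMatrix_apply, Matrix.map_apply, Matrix.of_apply, Φ, map_sum] at hAB
      obtain ⟨r, hr, hne⟩ := Finset.exists_ne_zero_of_sum_ne_zero hAB
      obtain ⟨hr, hA⟩ := Finset.mem_filter.1 hr
      exact ⟨r, hr, hA, (hp r hr (hA ▸ A.2)).2 B hne⟩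
    · intro A hA
      exact (hunamb.uniqueParse A.2).not_transGen_self A.2.productive
        (hA.lift Subtype.val fun _ _ h => h)

/-! ### Runs with bounds on their cost -/

/-- `Exec c s s' lo hi`: the program `c` leads from `s` to `s'` with at least `lo` arithmetic
operations and at most `hi` steps, the arithmetic operations being among the steps. -/
def Exec (c : Prog) (s s' : State) (lo hi : ℕ) : Prop :=
  ∃ k : Cost, run c s = some (s', k) ∧ lo ≤ k.arith ∧ k.arith ≤ k.steps ∧ k.steps ≤ hi

theorem Exec.mono {c : Prog} {s s' : State} {lo hi lo' hi' : ℕ} (h : Exec c s s' lo hi)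
    (hlo : lo' ≤ lo) (hhi : hi ≤ hi') : Exec c s s' lo' hi' := by
  obtain ⟨k, h1, h2, h3, h4⟩ := h
  exact ⟨k, h1, hlo.trans h2, h3, h4.trans hhi⟩

theorem Exec.skip (s : State) : Exec .skip s s 0 0 :=
  ⟨⟨0, 0⟩, by simp [run], le_rfl, le_rfl, le_rfl⟩

theorem Exec.seq {c d : Prog} {s s' s'' : State} {lo hi lo' hi' : ℕ} (hc : Exec c s s' lo hi)
    (hd : Exec d s' s'' lo' hi') : Exec (.seq c d) s s'' (lo + lo') (hi + hi') := by
  obtain ⟨k, h1, h2, h3, h4⟩ := hc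
  obtain ⟨l, h1', h2', h3', h4'⟩ := hd
  exact ⟨⟨k.arith + l.arith, k.steps + l.steps⟩, by simp [run, h1, h1'], add_le_add h2 h2',
    add_le_add h3 h3', add_le_add h4 h4'⟩

theorem Exec.idxConst (i k : ℕ) (s : State) :
    Exec (.idxConst i k) s { s with idx := Function.update s.idx i k } 0 1 :=
  ⟨⟨0, 1⟩, by simp [run], le_rfl, zero_le_one, le_rfl⟩

theorem Exec.idxAdd (i j k : ℕ) (s : State) :
    Exec (.idxAdd i j k) s
      { s with idx := Function.update s.idx i (s.idx j + s.idx k) } 0 1 :=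
  ⟨⟨0, 1⟩, by simp [run], le_rfl, zero_le_one, le_rfl⟩

theorem Exec.const (i : ℕ) (x : ℝ) (s : State) :
    Exec (.const i x) s { s with reg := Function.update s.reg i x } 0 1 :=
  ⟨⟨0, 1⟩, by simp [run], le_rfl, zero_le_one, le_rfl⟩

theorem Exec.load (i a j : ℕ) (s : State) :
    Exec (.load i a j) s
      { s with reg := Function.update s.reg i (s.mem a (s.idx j)) } 0 1 :=
  ⟨⟨0, 1⟩, by simp [run], le_rfl, zero_le_one, le_rfl⟩

theorem Exec.store (a j i : ℕ) (s : State) :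
    Exec (.store a j i) s ⟨s.idx, s.reg,
      Function.update s.mem a (Function.update (s.mem a) (s.idx j) (s.reg i))⟩ 0 1 :=
  ⟨⟨0, 1⟩, by simp [run], le_rfl, zero_le_one, le_rfl⟩

theorem Exec.arith {op : ArithOp} {i j k : ℕ} {s : State} {x : ℝ}
    (h : op.apply (s.reg j) (s.reg k) = some x) :
    Exec (.arith op i j k) s { s with reg := Function.update s.reg i x } 1 1 :=
  ⟨⟨1, 1⟩, by simp [run, h], le_rfl, le_rfl, le_rfl⟩

theorem Exec.add (i j k : ℕ) (s : State) :
    Exec (.arith .add i j k) s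
      { s with reg := Function.update s.reg i (s.reg j + s.reg k) } 1 1 :=
  .arith rfl

theorem Exec.sub (i j k : ℕ) (s : State) :
    Exec (.arith .sub i j k) s
      { s with reg := Function.update s.reg i (s.reg j - s.reg k) } 1 1 :=
  .arith rfl

theorem Exec.mul (i j k : ℕ) (s : State) :
    Exec (.arith .mul i j k) s
      { s with reg := Function.update s.reg i (s.reg j * s.reg k) } 1 1 :=
  .arith rfl

theorem Exec.div (i j k : ℕ) (s : State) (h : s.reg k ≠ 0) :
    Exec (.arith .div i j k) s
      { s with reg := Function.update s.reg i (s.reg j / s.reg k) } 1 1 :=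
  .arith (by simp [ArithOp.apply, h])

theorem Exec.ifZero {i : ℕ} {c d : Prog} {s s' : State} {lo hi : ℕ}
    (h₁ : s.reg i = 0 → Exec c s s' lo hi) (h₂ : s.reg i ≠ 0 → Exec d s s' lo hi) :
    Exec (.ifZero i c d) s s' lo (hi + 1) := by
  by_cases h : s.reg i = 0
  · obtain ⟨k, h1, h2, h3, h4⟩ := h₁ h
    exact ⟨⟨k.arith, k.steps + 1⟩, by simp [run, h, h1], h2, Nat.le_succ_of_le h3,
      Nat.succ_le_succ h4⟩
  · obtain ⟨k, h1, h2, h3, h4⟩ := h₂ h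
    exact ⟨⟨k.arith, k.steps + 1⟩, by simp [run, h, h1], h2, Nat.le_succ_of_le h3,
      Nat.succ_le_succ h4⟩

theorem Exec.ifLe {i j : ℕ} {c d : Prog} {s s' : State} {lo hi : ℕ}
    (h₁ : s.idx i ≤ s.idx j → Exec c s s' lo hi) (h₂ : ¬ s.idx i ≤ s.idx j → Exec d s s' lo hi) :
    Exec (.ifLe i j c d) s s' lo (hi + 1) := by
  by_cases h : s.idx i ≤ s.idx j
  · obtain ⟨k, h1, h2, h3, h4⟩ := h₁ h
    exact ⟨⟨k.arith, k.steps + 1⟩, by simp [run, h, h1], h2, Nat.le_succ_of_le h3,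
      Nat.succ_le_succ h4⟩
  · obtain ⟨k, h1, h2, h3, h4⟩ := h₂ h
    exact ⟨⟨k.arith, k.steps + 1⟩, by simp [run, h, h1], h2, Nat.le_succ_of_le h3,
      Nat.succ_le_succ h4⟩

/-- The rule of the loop invariant. -/
theorem Exec.loop {j : ℕ} {c : Prog} {lo hi : ℕ} (I : ℕ → State → Prop)
    (hI : ∀ t s, I t s → ∃ s', Exec c s s' lo hi ∧ I (t + 1) s') {s : State} (h0 : I 0 s) :
    ∃ s', Exec (.loop j c) s s' (s.idx j * lo) (s.idx j * (hi + 1) + 1) ∧ I (s.idx j) s' := by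
  have key : ∀ n t s, I t s → ∃ s' k, iter (run c) n s = some (s', k) ∧ n * lo ≤ k.arith ∧
      k.arith ≤ k.steps ∧ k.steps ≤ n * (hi + 1) ∧ I (t + n) s' := by
    intro n
    induction n with
    | zero => exact fun t s hs => ⟨s, ⟨0, 0⟩, rfl, by simp, by simp, by simp, hs⟩
    | succ n ih =>
      intro t s hs
      obtain ⟨s', ⟨k, h1, h2, h3, h4⟩, hs'⟩ := hI t s hs
      obtain ⟨s'', l, h1', h2', h3', h4', hs''⟩ := ih (t + 1) s' hs'
      refine ⟨s'', ⟨k.arith + l.arith, k.steps + l.steps + 1⟩, by simp [iter, h1, h1'],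
        ?_, ?_, ?_, ?_⟩
      · rw [Nat.succ_mul, add_comm]; exact add_le_add h2 h2'
      · exact Nat.le_succ_of_le (add_le_add h3 h3')
      · rw [Nat.succ_mul]; dsimp only; omega
      · rwa [show t + (n + 1) = t + 1 + n by omega]
  obtain ⟨s', k, h1, h2, h3, h4, h5⟩ := key (s.idx j) 0 s h0
  exact ⟨s', ⟨⟨k.arith, k.steps + 1⟩, by simp [run, h1], h2, Nat.le_succ_of_le h3,
    Nat.succ_le_succ h4⟩, by simpa using h5⟩

/-! ### Tabulating a holonomic sequence -/

/-- Horner's scheme: the value of a polynomial at the number in register `1`. -/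
theorem exists_prog_eval (p : ℝ[X]) : ∃ (c : Prog) (B : ℕ), ∀ s, ∃ s', Exec c s s' 0 B ∧
    s'.reg 2 = p.eval (s.reg 1) ∧ s'.idx = s.idx ∧ s'.mem = s.mem ∧
    ∀ i, i ≠ 2 → i ≠ 3 → s'.reg i = s.reg i := by
  induction p using Polynomial.recOnHorner with
  | M0 =>
    refine ⟨.const 2 0, 1, fun s => ⟨_, .const 2 0 s, by simp, rfl, rfl, fun i h2 _ => ?_⟩⟩
    simp [h2]
  | MC p a _ _ ih =>
    obtain ⟨c, B, h⟩ := ih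
    refine ⟨.seq c (.seq (.const 3 a) (.arith .add 2 2 3)), B + (1 + 1), fun s => ?_⟩
    obtain ⟨s', hs, h1, h2, h3, h4⟩ := h s
    refine ⟨_, (hs.seq ((Exec.const 3 a _).seq (.add 2 2 3 _))).mono (Nat.zero_le _) le_rfl,
      ?_, h2, h3, fun i hi2 hi3 => ?_⟩
    · simp [h1]
    · simp [hi2, hi3, h4]
  | MX p _ ih =>
    obtain ⟨c, B, h⟩ := ih
    refine ⟨.seq c (.arith .mul 2 2 1), B + 1, fun s => ?_⟩
    obtain ⟨s', hs, h1, h2, h3, h4⟩ := h s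
    refine ⟨_, (hs.seq (.mul 2 2 1 _)).mono (Nat.zero_le _) le_rfl, ?_, h2, h3,
      fun i hi2 hi3 => ?_⟩
    · simp [h1, h4]
    · simp [hi2, hi3, h4]

/-- The sum of a recurrence, at the argument that register `1` and index register `1` hold. -/
theorem exists_prog_sum (p : ℕ → ℝ[X]) (a d : ℕ) : ∃ (c : Prog) (B : ℕ), ∀ s, ∃ s',
    Exec c s s' 0 B ∧
    s'.reg 4 = ∑ k ∈ Finset.range d, (p k).eval (s.reg 1) * s.mem a (s.idx 1 + k) ∧
    s'.reg 1 = s.reg 1 ∧ s'.idx 0 = s.idx 0 ∧ s'.idx 1 = s.idx 1 ∧ s'.mem = s.mem := by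
  induction d with
  | zero =>
    exact ⟨.const 4 0, 1, fun s => ⟨_, .const 4 0 s, by simp, by simp, rfl, rfl, rfl⟩⟩
  | succ d ih =>
    obtain ⟨c, B, h⟩ := ih
    obtain ⟨c', B', h'⟩ := exists_prog_eval (p d)
    refine ⟨.seq c (.seq c' (.seq (.idxConst 2 d) (.seq (.idxAdd 2 1 2) (.seq (.load 3 a 2)
      (.seq (.arith .mul 2 2 3) (.arith .add 4 4 2)))))), B + (B' + (1 + (1 + (1 + (1 + 1))))),
      fun s => ?_⟩
    obtain ⟨s', hs, h1, h2, h3, h4, h5⟩ := h s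
    obtain ⟨s'', hs', h1', h2', h3', h4'⟩ := h' s'
    refine ⟨_, (hs.seq (hs'.seq ((Exec.idxConst 2 d _).seq ((Exec.idxAdd 2 1 2 _).seq
      ((Exec.load 3 a 2 _).seq ((Exec.mul 2 2 3 _).seq (.add 4 4 2 _))))))).mono
        (Nat.zero_le _) le_rfl, ?_, ?_, ?_, ?_, ?_⟩
    · simp [h1, h1', h2, h2', h3', h4, h4', h5, Finset.sum_range_succ]
    · simp [h2, h4']
    · simp [h3, h2']
    · simp [h4, h2']
    · simp [h5, h3']

theorem exists_prog_table (a : ℕ → ℝ) (A n : ℕ) : ∃ (c : Prog) (B : ℕ), ∀ s, ∃ s',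
    Exec c s s' 0 B ∧ s'.idx 0 = s.idx 0 ∧ (∀ j < n, s'.mem A j = a j) ∧
    ∀ b ≠ A, s'.mem b = s.mem b := by
  induction n with
  | zero => exact ⟨.skip, 0, fun s => ⟨s, .skip s, rfl, by simp, by simp⟩⟩
  | succ n ih =>
    obtain ⟨c, B, h⟩ := ih
    refine ⟨.seq c (.seq (.idxConst 2 n) (.seq (.const 2 (a n)) (.store A 2 2))),
      B + (1 + (1 + 1)), fun s => ?_⟩
    obtain ⟨s', hs, h1, h2, h3⟩ := h s
    refine ⟨_, (hs.seq ((Exec.idxConst 2 n _).seq ((Exec.const 2 (a n) _).seq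
      (.store A 2 2 _)))).mono (Nat.zero_le _) le_rfl, ?_, ?_, ?_⟩
    · simp [h1]
    · intro j hj
      by_cases hjn : j = n
      · simp [hjn]
      · simp [hjn, h2 j (by omega)]
    · intro b hb
      simp [hb, h3 b hb]

/-- A holonomic sequence is tabulated in linear time: beyond the zeros of the leading coefficient,
each value is obtained from its predecessors by a bounded number of operations; the finitely many
values before are constants of the program. -/
theorem IsHolonomic.exists_prog {a : ℕ → ℝ} (ha : IsHolonomic a) (A : ℕ) :
    ∃ (c : Prog) (B : ℕ), ∀ s, ∃ s', Exec c s s' 0 (B * (s.idx 0 + 1)) ∧ s'.idx 0 = s.idx 0 ∧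
      (∀ j ≤ s.idx 0, s'.mem A j = a j) ∧ ∀ b ≠ A, s'.mem b = s.mem b := by
  obtain ⟨d, p, hd, hrec⟩ := ha
  obtain ⟨M, hM1, hM⟩ : ∃ M : ℕ, 1 ≤ M ∧ ∀ m : ℕ, M ≤ m → (p d).eval (m : ℝ) ≠ 0 := by
    obtain ⟨b, hb⟩ := ((p d).roots.toFinset.finite_toSet).bddAbove
    obtain ⟨M, hM⟩ := exists_nat_gt b
    refine ⟨M + 1, by omega, fun m hm h0 => ?_⟩
    have h1 : (m : ℝ) ≤ b := hb (by simpa [hd] using h0)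
    have h2 : ((M + 1 : ℕ) : ℝ) ≤ m := by exact_mod_cast hm
    push_cast at h2
    linarith
  obtain ⟨c₀, B₀, h₀⟩ := exists_prog_table a A (M + d)
  obtain ⟨c₁, B₁, h₁⟩ := exists_prog_sum p A d
  obtain ⟨c₂, B₂, h₂⟩ := exists_prog_eval (p d)
  let body : Prog := .seq c₁ (.seq c₂ (.seq (.arith .div 4 4 2) (.seq (.const 3 0)
    (.seq (.arith .sub 4 3 4) (.seq (.idxConst 2 d) (.seq (.idxAdd 2 1 2) (.seq (.store A 2 4)
    (.seq (.idxConst 2 1) (.seq (.idxAdd 1 1 2) (.seq (.const 3 1) (.arith .add 1 1 3)))))))))))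
  let B : ℕ := B₁ + (B₂ + 10)
  refine ⟨.seq c₀ (.seq (.idxConst 1 M) (.seq (.const 1 M) (.loop 0 body))), B₀ + B + 4,
    fun s => ?_⟩
  let I : ℕ → State → Prop := fun t s' => s'.idx 0 = s.idx 0 ∧ s'.idx 1 = M + t ∧
    s'.reg 1 = ((M + t : ℕ) : ℝ) ∧ (∀ j < M + d + t, s'.mem A j = a j) ∧
    ∀ b ≠ A, s'.mem b = s.mem b
  have hI : ∀ t s, I t s → ∃ s', Exec body s s' 0 B ∧ I (t + 1) s' := by
    rintro t s ⟨hi0, hi1, hr1, hmem, hframe⟩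
    obtain ⟨s₁, hs₁, h11, h12, h13, h14, h15⟩ := h₁ s
    obtain ⟨s₂, hs₂, h21, h22, h23, h24⟩ := h₂ s₁
    have hne : s₂.reg 2 ≠ 0 := by
      rw [h21, h12, hr1]
      exact hM _ (by omega)
    have hval : 0 - s₂.reg 4 / s₂.reg 2 = a (M + t + d) := by
      have h := hrec (M + t)
      rw [Finset.sum_range_succ] at h
      have hsum : s₂.reg 4 =
          ∑ k ∈ Finset.range d, (p k).eval ((M + t : ℕ) : ℝ) * a (M + t + k) := by
        rw [h24 4 (by decide) (by decide), h11, hr1, hi1]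
        refine Finset.sum_congr rfl fun k hk => ?_
        rw [hmem _ (by have := Finset.mem_range.1 hk; omega)]
      have h2 : s₂.reg 2 = (p d).eval ((M + t : ℕ) : ℝ) := by rw [h21, h12, hr1]
      rw [hsum, h2]
      rw [h2] at hne
      field_simp
      linarith
    refine ⟨_, (hs₁.seq (hs₂.seq ((Exec.div 4 4 2 _ hne).seq ((Exec.const 3 0 _).seq
      ((Exec.sub 4 3 4 _).seq ((Exec.idxConst 2 d _).seq ((Exec.idxAdd 2 1 2 _).seq
      ((Exec.store A 2 4 _).seq ((Exec.idxConst 2 1 _).seq ((Exec.idxAdd 1 1 2 _).seq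
      ((Exec.const 3 1 _).seq (.add 1 1 3 _)))))))))))).mono (Nat.zero_le _) le_rfl,
      ?_, ?_, ?_, ?_, ?_⟩
    · simp [h13, h22, hi0]
    · simp [h14, h22, hi1]; omega
    · simp [h12, h24, hr1]; ring
    · intro j hj
      by_cases hjn : j = M + t + d
      · subst hjn
        simpa [h14, h22, hi1] using hval
      · have := hmem j (by omega)
        simp [h14, h15, h22, h23, hi1, hjn, this]
    · intro b hb
      simp [h15, h23, hb, hframe b hb]
  obtain ⟨s₀, hs₀, h01, h02, h03⟩ := h₀ s
  obtain ⟨s', hs', hfin⟩ := Exec.loop (j := 0) I hI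
    (s := { s₀ with idx := Function.update s₀.idx 1 M, reg := Function.update s₀.reg 1 (M : ℝ) })
    ⟨by simp [h01], by simp, by simp, by simpa using h02, h03⟩
  have hidx : (Function.update s₀.idx 1 M) 0 = s.idx 0 := by simp [h01]
  simp only [hidx] at hs' hfin
  refine ⟨s', (hs₀.seq ((Exec.idxConst 1 M _).seq ((Exec.const 1 M _).seq hs'))).mono
    (Nat.zero_le _) ?_, hfin.1, fun j hj => hfin.2.2.2.1 j (by omega), hfin.2.2.2.2⟩
  nlinarith [Nat.zero_le (B₀ * s.idx 0), Nat.zero_le (s.idx 0)]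

/-- Several tables are filled one after the other. -/
theorem exists_prog_tables {ι : Type} {enc : ι → ℕ} (henc : Function.Injective enc)
    {a : ι → ℕ → ℝ} (l : List ι) (ha : ∀ i ∈ l, IsHolonomic (a i)) :
    ∃ (c : Prog) (B : ℕ), ∀ s, ∃ s', Exec c s s' 0 (B * (s.idx 0 + 1)) ∧ s'.idx 0 = s.idx 0 ∧
      (∀ i ∈ l, ∀ j ≤ s.idx 0, s'.mem (enc i) j = a i j) ∧
      ∀ b, (∀ i ∈ l, b ≠ enc i) → s'.mem b = s.mem b := by
  induction l with
  | nil => exact ⟨.skip, 0, fun s => ⟨s, (Exec.skip s).mono le_rfl (by simp), rfl, by simp,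
      by simp⟩⟩
  | cons i l ih =>
    obtain ⟨c, B, h⟩ := ih fun i hi => ha i (List.mem_cons_of_mem _ hi)
    obtain ⟨c₀, B₀, h₀⟩ := (ha i List.mem_cons_self).exists_prog (enc i)
    refine ⟨.seq c₀ c, B₀ + B, fun s => ?_⟩
    obtain ⟨s₀, hs₀, h01, h02, h03⟩ := h₀ s
    obtain ⟨s', hs', h1, h2, h3⟩ := h s₀
    refine ⟨s', (hs₀.seq hs').mono (Nat.zero_le _) (by rw [h01, add_mul]), h1.trans h01, ?_, ?_⟩
    · intro k hk j hj
      by_cases hkl : k ∈ l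
      · exact h2 k hkl j (h01.symm ▸ hj)
      · obtain rfl : k = i := (List.mem_cons.1 hk).resolve_right hkl
        rw [h3 _ fun i' hi' he => hkl (by rwa [henc he]), h02 j hj]
    · intro b hb
      rw [h3 b fun i' hi' => hb i' (List.mem_cons_of_mem _ hi'),
        h03 b (hb i List.mem_cons_self)]

/-- A tabulation that performs at least as many arithmetic operations as its input says: the idle
loop makes the lower bound independent of the number of tables, which may be zero. -/
theorem exists_prog_tables_linear {ι : Type} {enc : ι → ℕ} (henc : Function.Injective enc)
    {a : ι → ℕ → ℝ} (l : List ι) (ha : ∀ i ∈ l, IsHolonomic (a i)) :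
    ∃ (c : Prog) (B : ℕ), ∀ n, ∃ s', Exec c (initState n) s' n (B * (n + 1)) ∧
      (∀ i ∈ l, ∀ j ≤ n, s'.mem (enc i) j = a i j) ∧
      ∀ b, (∀ i ∈ l, b ≠ enc i) → ∀ j, s'.mem b j = 0 := by
  obtain ⟨c, B, h⟩ := exists_prog_tables henc l ha
  refine ⟨.seq (.loop 0 (.arith .add 0 0 0)) c, B + 2, fun n => ?_⟩
  obtain ⟨s₀, hs₀, hi, hm⟩ := Exec.loop (j := 0) (c := .arith .add 0 0 0) (lo := 1) (hi := 1)
    (fun _ s => s.idx = (initState n).idx ∧ s.mem = (initState n).mem)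
    (fun _ s hs => ⟨_, .add 0 0 0 s, hs⟩) (s := initState n) ⟨rfl, rfl⟩
  have hn : (initState n).idx 0 = n := by simp [initState]
  obtain ⟨s', hs', -, h2, h3⟩ := h s₀
  rw [hi, hn] at hs' h2
  rw [hn] at hs₀
  refine ⟨s', (hs₀.seq hs').mono (by omega) (by rw [add_mul]; omega), h2, fun b hb j => ?_⟩
  rw [h3 b hb, hm]
  rfl

/-! ### The update of a weight in constant time -/

/-- The weight of a symbol with an attached length as the memory `mem` has it, where the array
`enc N` belongs to the non-terminal `N`. -/
noncomputable def storedWeight (wt : T → ℝ) (enc : g.NT → ℕ) (mem : ℕ → ℕ → ℝ) :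
    Symbol T g.NT × ℕ → ℝ
  | (.nonterminal A, m) => mem (enc A) m
  | (.terminal t, m) => if m = 1 then wt t else 0

/-- Multiply register `1` by the stored weights of the symbols of a word, whose lengths are in
the index registers from `k` on; index register `0` holds the constant one. -/
theorem exists_prog_storedWeight (wt : T → ℝ) (enc : g.NT → ℕ) (l : List (Symbol T g.NT))
    (k : ℕ) : ∃ (c : Prog) (B : ℕ), ∀ (X : SizedWord g) (s : State), X.map Prod.fst = l →
      s.idx 0 = 1 → (∀ (i : ℕ) (hi : i < X.length), s.idx (k + i) = (X[i]).2) →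
      ∃ s', Exec c s s' 0 B ∧
        s'.reg 1 = s.reg 1 * (X.map (storedWeight wt enc s.mem)).prod ∧ s'.idx = s.idx ∧
        s'.mem = s.mem ∧ ∀ i, i ≠ 1 → i ≠ 2 → s'.reg i = s.reg i := by
  induction l generalizing k with
  | nil =>
    refine ⟨.skip, 0, fun X s hX _ _ => ⟨s, .skip s, ?_, rfl, rfl, fun _ _ _ => rfl⟩⟩
    rw [List.map_eq_nil_iff.1 hX]
    simp
  | cons x l ih =>
    obtain ⟨c, B, h⟩ := ih (k + 1)
    -- the first symbol, whose stored weight is put into register `2`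
    obtain ⟨c₀, B₀, h₀⟩ : ∃ (c₀ : Prog) (B₀ : ℕ), ∀ s : State, s.idx 0 = 1 →
        Exec c₀ s
          { s with reg := Function.update s.reg 2 (storedWeight wt enc s.mem (x, s.idx k)) }
          0 B₀ := by
      cases x with
      | nonterminal A => exact ⟨.load 2 (enc A) k, 1, fun s _ => .load 2 (enc A) k s⟩
      | terminal t =>
        refine ⟨.ifLe k 0 (.ifLe 0 k (.const 2 (wt t)) (.const 2 0)) (.const 2 0),
          3, fun s hs => ?_⟩
        by_cases h1 : s.idx k = 1
        · have e : storedWeight wt enc s.mem (.terminal t, s.idx k) = wt t := if_pos h1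
          rw [e]
          exact .ifLe (fun _ => .ifLe (fun _ => .const 2 _ s) (fun h => (h (by omega)).elim))
            (fun h => (h (by omega)).elim)
        · have e : storedWeight wt enc s.mem (.terminal t, s.idx k) = 0 := if_neg h1
          rw [e]
          exact .ifLe (fun h => .ifLe (fun h' => (h1 (by omega)).elim) (fun _ => .const 2 0 s))
            (fun _ => (Exec.const 2 0 s).mono le_rfl one_le_two)
    refine ⟨.seq c₀ (.seq (.arith .mul 1 1 2) c), B₀ + (1 + B), fun X s hX hs hidx => ?_⟩
    obtain ⟨⟨y, m⟩, X, rfl⟩ : ∃ p X', X = p :: X' := by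
      cases X with
      | nil => cases hX
      | cons p X' => exact ⟨p, X', rfl⟩
    obtain ⟨rfl, hXl⟩ := List.cons.inj hX
    have hm : s.idx k = m := hidx 0 (by simp)
    have e1 := h₀ s hs
    obtain ⟨s', hs', h1, h2, h3, h4⟩ := h X (s := { s with
        reg := Function.update
          (Function.update s.reg 2 (storedWeight wt enc s.mem (y, s.idx k))) 1
          (s.reg 1 * storedWeight wt enc s.mem (y, s.idx k)) }) hXl hs fun i hi => by
      have := hidx (i + 1) (by simpa using hi)
      simpa [add_assoc, add_comm 1] using this
    have e3 := Exec.mul 1 1 2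
      { s with reg := Function.update s.reg 2 (storedWeight wt enc s.mem (y, s.idx k)) }
    simp only [Function.update_self, ne_eq, OfNat.one_ne_ofNat, not_false_eq_true,
      Function.update_of_ne] at e3
    refine ⟨s', (e1.seq (e3.seq hs')).mono (Nat.zero_le _) le_rfl, ?_, h2, h3,
      fun i hi1 hi2 => ?_⟩
    · rw [h1, hm]
      simp [mul_assoc]
    · rw [h4 i hi1 hi2]
      simp [hi1, hi2]

/-- The update for a rule: division by the stored weight of the non-terminal, with the result zero
if that is zero. -/
theorem exists_prog_update (wt : T → ℝ) (enc : g.NT → ℕ) (r : ContextFreeRule T g.NT) :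
    ∃ (c : Prog) (B : ℕ), ∀ (X : SizedWord g) (s : State), X.map Prod.fst = r.output →
      (∀ (k : ℕ) (hk : k < X.length), s.idx (k + 1) = (X[k]).2) →
      ∃ s', Exec c s s' 0 B ∧ s'.mem = s.mem ∧
        s'.reg 0 = s.reg 0 * (X.map (storedWeight wt enc s.mem)).prod
          / s.mem (enc r.input) (s.idx 0) := by
  obtain ⟨c, B, h⟩ := exists_prog_storedWeight wt enc r.output 1
  refine ⟨.seq (.load 3 (enc r.input) 0) (.seq (.idxConst 0 1) (.seq (.const 1 1)
    (.seq c (.seq (.arith .mul 0 0 1) (.ifZero 3 (.const 0 0) (.arith .div 0 0 3)))))),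
    1 + (1 + (1 + (B + (1 + (1 + 1))))), fun X s hX hidx => ?_⟩
  obtain ⟨s', hs', h1, h2, h3, h4⟩ := h X ⟨Function.update s.idx 0 1, Function.update
      (Function.update s.reg 3 (s.mem (enc r.input) (s.idx 0))) 1 1, s.mem⟩ hX (by simp)
    fun i hi => by simpa [add_comm 1] using hidx i hi
  have h13 : s'.reg 3 = s.mem (enc r.input) (s.idx 0) := by simp [h4]
  have h10 : s'.reg 0 = s.reg 0 := by simp [h4]
  have hif : Exec (.ifZero 3 (.const 0 0) (.arith .div 0 0 3))
      { s' with reg := Function.update s'.reg 0 (s'.reg 0 * s'.reg 1) }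
      { s' with
        reg := Function.update (Function.update s'.reg 0 (s'.reg 0 * s'.reg 1)) 0
          (s'.reg 0 * s'.reg 1 / s'.reg 3) } 0 (1 + 1) := by
    refine .ifZero (fun h0 => ?_) (fun h0 => ?_)
    · have h0 : s'.reg 3 = 0 := by simpa using h0
      rw [h0, div_zero]
      exact .const 0 0 _
    · have := (Exec.div 0 0 3 _ h0).mono (Nat.zero_le 1) le_rfl
      simpa using this
  refine ⟨_, ((Exec.load 3 (enc r.input) 0 _).seq ((Exec.idxConst 0 1 _).seq
    ((Exec.const 1 1 _).seq (hs'.seq ((Exec.mul 0 0 1 _).seq hif))))).mono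
      (Nat.zero_le _) le_rfl, ?_, ?_⟩
  · simpa using h3
  · simp [h10, h13, h1]

/-- Stored weights of useful non-terminals, and zeros elsewhere, suffice for the right-hand sides
of the rules of a useful non-terminal: one with a useless symbol generates nothing. -/
theorem prod_storedWeight [Finite T] {enc : g.NT → ℕ} {mem : ℕ → ℕ → ℝ} {n : ℕ}
    (hmem : ∀ N, Useful g N → ∀ j ≤ n, mem (enc N) j = ntWeight wt g N j)
    (hmem0 : ∀ N, ¬ Useful g N → ∀ j, mem (enc N) j = 0)
    {r : ContextFreeRule T g.NT} (hr : r ∈ g.rules) (hu : Useful g r.input) {X : SizedWord g}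
    (hX : X.map Prod.fst = r.output) (hn : totalLength X ≤ n) :
    (X.map (storedWeight wt enc mem)).prod = weight wt g X := by
  by_cases hp : Productive g r.output
  · have hall : ∀ A m, (Symbol.nonterminal A, m) ∈ X → Useful g A := fun A m hA =>
      hu.of_rule hr hp (hX ▸ List.mem_map_of_mem (f := Prod.fst) hA)
    clear hX
    induction X with
    | nil => simp [weight_nil]
    | cons p X ih =>
      have hn' : p.2 + totalLength X ≤ n := by simpa [totalLength] using hn
      rw [List.map_cons, List.prod_cons, weight_cons,
        ih (by omega) fun A m hA => hall A m (List.mem_cons_of_mem _ hA)]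
      congr 1
      obtain ⟨x, m⟩ := p
      cases x with
      | nonterminal A => exact hmem A (hall A m List.mem_cons_self) m (by dsimp only at hn'; omega)
      | terminal t => rw [weight_singleton, languageWeight_formLanguage_terminal]; rfl
  · rw [weight_eq_zero_of_not_productive (hX ▸ hp), List.prod_eq_zero_iff]
    have : ∃ A, Symbol.nonterminal A ∈ r.output ∧ ¬ Useful g A := by
      by_contra! hall
      apply hp
      have : ∀ l : List (Symbol T g.NT), (∀ A, Symbol.nonterminal A ∈ l → Useful g A) →
          Productive g l := by
        intro l hl
        induction l with
        | nil => exact ⟨[], .refl _⟩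
        | cons x l ih =>
          refine (productive_append (ω₁ := [x])).2
            ⟨?_, ih fun A hA => hl A (List.mem_cons_of_mem _ hA)⟩
          cases x with
          | nonterminal A => exact (hl A List.mem_cons_self).productive
          | terminal t => exact ⟨[t], .refl _⟩
      exact this _ hall
    obtain ⟨A, hA, hAu⟩ := this
    rw [← hX] at hA
    obtain ⟨⟨x, m⟩, hm, rfl⟩ := List.mem_map.1 hA
    exact List.mem_map.2 ⟨_, hm, hmem0 A hAu m⟩

theorem weight_update_stored [Finite T] {enc : g.NT → ℕ} {mem : ℕ → ℕ → ℝ} {n : ℕ}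
    (hmem : ∀ N, Useful g N → ∀ j ≤ n, mem (enc N) j = ntWeight wt g N j)
    (hmem0 : ∀ N, ¬ Useful g N → ∀ j, mem (enc N) j = 0)
    {r : ContextFreeRule T g.NT} (hr : r ∈ g.rules) {α β X : SizedWord g} {m : ℕ}
    (hX : X.map Prod.fst = r.output) (hXm : totalLength X = m)
    (hn : totalLength (α ++ [(Symbol.nonterminal r.input, m)] ++ β) ≤ n)
    (hacc : g.Derives [Symbol.nonterminal g.initial]
        ((α ++ [(Symbol.nonterminal r.input, m)] ++ β).map Prod.fst) ∨
      ∀ N : g.NT, Symbol.nonterminal N ∈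
        (α ++ [(Symbol.nonterminal r.input, m)] ++ β).map Prod.fst → Useful g N)
    (hpos : (∀ t, 0 ≤ wt t) ∨ ntWeight wt g r.input m ≠ 0) :
    weight wt g (α ++ [(Symbol.nonterminal r.input, m)] ++ β) *
      (X.map (storedWeight wt enc mem)).prod / mem (enc r.input) m =
        weight wt g (α ++ X ++ β) := by
  have hmn : m ≤ n := by
    simp only [totalLength, List.map_append, List.map_cons, List.map_nil, List.sum_append,
      List.sum_cons, List.sum_nil] at hn
    omega
  by_cases hu : Useful g r.input
  · rw [hmem _ hu m hmn, prod_storedWeight hmem hmem0 hr hu hX (hXm ▸ hmn)]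
    by_cases h0 : ntWeight wt g r.input m = 0
    · have hz := weight_output_eq_zero (hpos.resolve_right (not_not.2 h0)) hr hX hXm h0
      rw [weight_append (α ++ X), weight_append α X, hz, h0]
      simp
    · exact (weight_update r α β X m h0).symm
  · -- the form is accessible, but no word is derived from it
    have hd := hacc.resolve_right fun h => hu (h _ (by simp))
    rw [hmem0 _ hu, div_zero, weight_eq_zero_of_not_productive]
    intro hp
    simp only [List.map_append, hX, List.map_cons, List.map_nil, productive_append] at hp hd
    refine hu (useful_of_mem hd ?_ (by simp))
    rw [productive_append, productive_append]
    exact ⟨⟨hp.1.1, productive_of_rule hr hp.1.2⟩, hp.2⟩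

theorem isTheta_of_linear_bounds {u : ℕ → ℕ} {B : ℕ} (h₁ : ∀ n, n ≤ u n)
    (h₂ : ∀ n, u n ≤ B * (n + 1)) :
    (fun n => (u n : ℝ)) =Θ[atTop] (fun n : ℕ => (n : ℝ)) := by
  constructor
  · refine IsBigO.of_bound (2 * B) ?_
    filter_upwards [eventually_ge_atTop 1] with n hn
    rw [Real.norm_natCast, Real.norm_natCast]
    have : u n ≤ 2 * B * n := (h₂ n).trans (by nlinarith)
    exact_mod_cast this
  · refine IsBigO.of_bound 1 (Eventually.of_forall fun n => ?_)
    rw [Real.norm_natCast, Real.norm_natCast, one_mul]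
    exact_mod_cast h₁ n

end ImmatureWords

open ImmatureWords in
theorem mainTheorem4 {T : Type*} [Finite T] (g : ContextFreeGrammar T) [Finite g.NT]
    (wt : T → ℝ) (hcnf : IsCNF g) (φ : DerivationPolicy g) (hunamb : Unambiguous φ) :
    -- the weights of each non-terminal obey a linear recurrence with polynomial coefficients
    (∀ N : g.NT, Useful g N → IsHolonomic (ntWeight wt g N)) ∧
    -- the update formula for an atomic derivation `α N_m β → α X β`
    (∀ r ∈ g.rules, ∀ (α β X : SizedWord g) (m : ℕ),
      X.map Prod.fst = r.output → totalLength X = m → ntWeight wt g r.input m ≠ 0 →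
      weight wt g (α ++ X ++ β) =
        weight wt g (α ++ [(Symbol.nonterminal r.input, m)] ++ β) * weight wt g X
          / ntWeight wt g r.input m) ∧
    -- the precomputation `pre`, and the constant-time updates `upd r`, one for each rule `r`
    ∃ (pre : Prog) (upd : ContextFreeRule T g.NT → Prog) (enc : g.NT → ℕ) (C : ℕ)
      (final : ℕ → State) (cost : ℕ → Cost),
      Function.Injective enc ∧
      (∀ n, run pre (initState n) = some (final n, cost n)) ∧
      (fun n => ((cost n).arith : ℝ)) =Θ[atTop] (fun n : ℕ => (n : ℝ)) ∧
      (fun n => ((cost n).steps : ℝ)) =Θ[atTop] (fun n : ℕ => (n : ℝ)) ∧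
      (∀ n, ∀ N : g.NT, Useful g N → ∀ j ≤ n, (final n).mem (enc N) j = ntWeight wt g N j) ∧
      (∀ (n : ℕ), ∀ r ∈ g.rules, ∀ (α β X : SizedWord g) (m : ℕ),
        X.map Prod.fst = r.output → totalLength X = m →
        totalLength (α ++ [(Symbol.nonterminal r.input, m)] ++ β) ≤ n →
        (g.Derives [Symbol.nonterminal g.initial]
            ((α ++ [(Symbol.nonterminal r.input, m)] ++ β).map Prod.fst) ∨
          ∀ N : g.NT, Symbol.nonterminal N ∈
            (α ++ [(Symbol.nonterminal r.input, m)] ++ β).map Prod.fst → Useful g N) →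
        ((∀ t, 0 ≤ wt t) ∨ ntWeight wt g r.input m ≠ 0) →
        ∀ s : State, s.mem = (final n).mem →
          s.reg 0 = weight wt g (α ++ [(Symbol.nonterminal r.input, m)] ++ β) →
          s.idx 0 = m →
          (∀ (k : ℕ) (hk : k < X.length), s.idx (k + 1) = (X[k]).2) →
          ∃ (s' : State) (c : Cost), run (upd r) s = some (s', c) ∧
            s'.reg 0 = weight wt g (α ++ X ++ β) ∧ s'.mem = s.mem ∧
            c.arith ≤ C ∧ c.steps ≤ C) := by
  classical
  have hhol : ∀ N : g.NT, Useful g N → IsHolonomic (ntWeight wt g N) :=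
    fun N hN => hunamb.isHolonomic_ntWeight hcnf hN
  refine ⟨hhol, fun r _ α β X m _ _ h => weight_update r α β X m h, ?_⟩
  let _ : Fintype g.NT := Fintype.ofFinite g.NT
  let enc : g.NT → ℕ := fun N => (Fintype.equivFin g.NT N : ℕ)
  have henc : Function.Injective enc :=
    Fin.val_injective.comp (Fintype.equivFin g.NT).injective
  obtain ⟨pre, B, hpre⟩ := exists_prog_tables_linear henc (a := ntWeight wt g)
    (Finset.univ.filter (Useful g)).toList fun N hN => hhol N (by simpa using hN)
  choose final hrun htab hzero using hpre
  choose cost hrun hlo hle hhi using hrun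
  choose upd D hupd using exists_prog_update wt enc
  refine ⟨pre, upd, enc, g.rules.sup D, final, cost, henc, hrun,
    isTheta_of_linear_bounds hlo fun n => (hle n).trans (hhi n),
    isTheta_of_linear_bounds (fun n => (hlo n).trans (hle n)) hhi,
    fun n N hN => htab n N (by simpa using hN), ?_⟩
  intro n r hr α β X m hX hXm hn hacc hpos s hsmem hs0 hsm hsX
  obtain ⟨s', ⟨c, h1, -, h3, h4⟩, hmem, hreg⟩ := hupd r X s hX hsX
  have hD : D r ≤ g.rules.sup D := Finset.le_sup hr
  refine ⟨s', c, h1, ?_, hmem, h3.trans (h4.trans hD), h4.trans hD⟩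
  rw [hreg, hs0, hsm, hsmem]
  refine weight_update_stored (n := n) (fun N hN => htab n N (by simpa using hN))
    (fun N hN => hzero n (enc N) fun N' hN' he => hN ?_) hr hX hXm hn hacc hpos
  rw [henc he]
  simpa using hN'
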